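/- Let $G$ be a second-countable unimodular locally compact (Hausdorff) group with Haar measure $\mu_G$, and fix a compact symmetric neighborhood $Q$ of the identity. A *Følner sequence* is a sequence $(K_n)_{n\in\mathbb N}$ of compact sets with $\mu_G(K_n)>0$ such that $\mu_G(K_nK\,\Delta\,K_n)/\mu_G(K_n)\to 0$ for every non-empty compact $K\subseteq G$; it is a *strong Følner sequence* if moreover $\mu_G(K_nK\cap K_n^cK)/\mu_G(K_n)\to 0$ for every compact $K\subseteq G$. Assume that $G$ is amenable, i.e. that it admits a Følner sequence. For $\Lambda\subseteq G$ the *lower Beurling density* is $$D^-(\Lambda)=\lim_{n\to\infty}\inf_{x\in G}\frac{\#(\Lambda\cap xK_n)}{\mu_G(K_n)},$$ where $(K_n)$ is any strong Følner sequence (the limit exists and does not depend on the sequence). Let $(\pi,\mathcal H_\pi)$ be a projective unitary representation of $G$ on a complex Hilbert space, i.e. a strongly measurable map $\pi$ from $G$ to the unitary operators of $\mathcal H_\pi$ with $\pi(xy)=\sigma(x,y)\pi(x)\pi(y)$ for some $\sigma:G\times G\to\mathbb T$. Write $V_gf(x)=\langle f,\pi(x)g\rangle$. Assume that $\pi$ is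 irreducible (no closed invariant subspaces other than $\{0\}$ and $\mathcal H_\pi$) and integrable (there is $g_0\neq 0$ with $V_{g_0}g_0\in L^1(G)$), and let $d_\pi>0$ be its formal degree, i.e. the number with $$\int_G\langle f_1,\pi(x)g_1\rangle\langle\pi(x)g_2,f_2\rangle\,d\mu_G(x)=d_\pi^{-1}\langle f_1,f_2\rangle\overline{\langle g_1,g_2\rangle}\qquad\text{for all } f_1,f_2,g_1,g_2\in\mathcal H_\pi .$$ Let $\mathcal B^1_\pi$ be the set of all $g\in\mathcal H_\pi$ such that $V_gg\in W^L(L^1)$, i.e. such that $V_gg\in L^\infty_{\mathrm{loc}}(G)$ and the local maximal function $x\mapsto\operatorname{ess\,sup}_{z\in Q}|V_gg(xz)|$ belongs to $L^1(G)$. A family $(v_i)_{i\in I}$ in $\mathcal H_\pi$ is a *frame* if there are $A,B>0$ with $A\|f\|^2\le\sum_{i\in I}|\langle f,v_i\rangle|^2\le B\|f\|^2$ for all $f\in\mathcal H_\pi$. **Theorem.** Let $\Lambda\subseteq G$ be discrete and let $g\in\mathcal B^1_\pi$. If $(\pi(\lambda)g)_{\lambda\in\Lambda}$ is a frame for $\mathcal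 H_\pi$ and $D^-(\Lambda)>d_\pi$, then there exists $\Gamma\subseteq\Lambda$ with $D^-(\Gamma)>0$ such that $(\pi(\lambda)g)_{\lambda\in\Lambda\setminus\Gamma}$ is a frame for $\mathcal H_\pi$. -/

import Mathlib

open MeasureTheory Filter Topology
open scoped ENNReal Pointwise

noncomputable section

/-! ### Følner sequences and lower Beurling density -/

/-- A (right) Følner sequence: non-null compact sets `K n` with
`μ (K n * C ∆ K n) / μ (K n) → 0` for every (non-empty) compact set `C`. -/
structure IsFolnerSeq {G : Type*} [Group G] [TopologicalSpace G] [MeasurableSpace G]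
    (μ : Measure G) (K : ℕ → Set G) : Prop where
  isCompact : ∀ n, IsCompact (K n)
  measure_ne_zero : ∀ n, μ (K n) ≠ 0
  tendsto_symmDiff : ∀ C : Set G, IsCompact C → C.Nonempty →
    Tendsto (fun n => μ (symmDiff (K n * C) (K n)) / μ (K n)) atTop (𝓝 0)

/-- A (right) strong Følner sequence: a Følner sequence with, in addition,
`μ (K n * C ∩ (K n)ᶜ * C) / μ (K n) → 0` for every compact set `C`. -/
structure IsStrongFolnerSeq {G : Type*} [Group G] [TopologicalSpace G] [MeasurableSpace G]
    (μ : Measure G) (K : ℕ → Set G) : Prop extends IsFolnerSeq μ K where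
  tendsto_boundary : ∀ C : Set G, IsCompact C →
    Tendsto (fun n => μ ((K n * C) ∩ ((K n)ᶜ * C)) / μ (K n)) atTop (𝓝 0)

/-- Amenability (of a second-countable locally compact group with Haar measure `μ`):
existence of a Følner sequence. -/
def IsAmenableGroup {G : Type*} [Group G] [TopologicalSpace G] [MeasurableSpace G]
    (μ : Measure G) : Prop :=
  ∃ K : ℕ → Set G, IsFolnerSeq μ K

/-- `inf_{x ∈ G} #(Λ ∩ x K) / μ(K)`. -/
def minRelativeCount {G : Type*} [Group G] [MeasurableSpace G]
    (μ : Measure G) (Λ K : Set G) : ℝ≥0∞ :=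
  ⨅ x : G, ((Λ ∩ x • K).encard : ℝ≥0∞) / μ K

/-- The lower Beurling density of `Λ` computed along the sequence `K`. It is written as a lower
limit so that it is meaningful without knowing that the limit exists. -/
def lowerBeurlingDensity {G : Type*} [Group G] [MeasurableSpace G]
    (μ : Measure G) (K : ℕ → Set G) (Λ : Set G) : ℝ≥0∞ :=
  liminf (fun n => minRelativeCount μ Λ (K n)) atTop

/-- `D` is the lower Beurling density of `Λ`: along every strong Følner sequence `K`, the limit of
`inf_{x ∈ G} #(Λ ∩ x K_n) / μ(K_n)` exists and equals `D`. -/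
def HasLowerBeurlingDensity {G : Type*} [Group G] [TopologicalSpace G] [MeasurableSpace G]
    (μ : Measure G) (Λ : Set G) (D : ℝ≥0∞) : Prop :=
  ∀ K : ℕ → Set G, IsStrongFolnerSeq μ K →
    Tendsto (fun n => minRelativeCount μ Λ (K n)) atTop (𝓝 D)

/-! ### The Wiener amalgam space `W^L(L¹)` -/

/-- The left-sided local maximal function `M^L F (x) = ess sup_{z ∈ Q} |F (x z)|`. -/
def localMaximal {G : Type*} [Group G] [MeasurableSpace G]
    (μ : Measure G) (Q : Set G) (F : G → ℂ) (x : G) : ℝ≥0∞ :=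
  essSup (fun z => ‖F (x * z)‖ₑ) (μ.restrict Q)

/-- `F ∈ W^L(L¹)`: `F` is locally essentially bounded and `M^L F` is integrable. -/
structure MemWienerL1 {G : Type*} [Group G] [TopologicalSpace G] [MeasurableSpace G]
    (μ : Measure G) (Q : Set G) (F : G → ℂ) : Prop where
  locallyBounded : ∀ C : Set G, IsCompact C → MemLp F ∞ (μ.restrict C)
  aemeasurable : AEMeasurable (localMaximal μ Q F) μ
  lintegral_lt_top : ∫⁻ x, localMaximal μ Q F x ∂μ < ∞

/-! ### Projective unitary representations -/

/-- A projective unitary representation: a strongly measurable map `π` into the unitary operators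
with `π (x y) = σ (x, y) π x π y` for a function `σ` with values in the unit circle. -/
structure ProjUnitaryRep (G : Type*) [Group G] [MeasurableSpace G]
    (H : Type*) [NormedAddCommGroup H] [InnerProductSpace ℂ H] where
  toFun : G → (H ≃ₗᵢ[ℂ] H)
  exists_cocycle : ∃ σ : G → G → Circle, ∀ x y : G, ∀ f : H,
    toFun (x * y) f = (σ x y : ℂ) • toFun x (toFun y f)
  stronglyMeasurable : ∀ f : H, StronglyMeasurable fun x => toFun x f

namespace ProjUnitaryRep

variable {G : Type*} [Group G] [MeasurableSpace G]
  {H : Type*} [NormedAddCommGroup H] [InnerProductSpace ℂ H]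

instance : CoeFun (ProjUnitaryRep G H) (fun _ => G → (H ≃ₗᵢ[ℂ] H)) := ⟨toFun⟩

/-- The matrix coefficient `V_g f (x) = ⟨f, π x g⟩`, where `⟨·, ·⟩` is linear in the first entry
(Mathlib's `inner` is linear in the second one). -/
def coeff (π : ProjUnitaryRep G H) (g f : H) (x : G) : ℂ :=
  inner ℂ (π x g) f

/-- Irreducibility: the only closed invariant subspaces are `0` and the whole space. -/
def IsIrreducible (π : ProjUnitaryRep G H) : Prop :=
  ∀ V : Submodule ℂ H, IsClosed (V : Set H) → (∀ x : G, ∀ f ∈ V, π x f ∈ V) → V = ⊥ ∨ V = ⊤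

/-- An integrable representation: irreducible, with a non-zero integrable vector. -/
structure IsIntegrableRep (π : ProjUnitaryRep G H) (μ : Measure G) : Prop where
  irreducible : π.IsIrreducible
  exists_integrable_vector : ∃ g : H, g ≠ 0 ∧ Integrable (π.coeff g g) μ

/-- `d > 0` satisfies the orthogonality relations
`∫ ⟨f₁, π x g₁⟩ ⟨π x g₂, f₂⟩ dμ(x) = d⁻¹ ⟨f₁, f₂⟩ conj ⟨g₁, g₂⟩`. -/
def IsFormalDegree (π : ProjUnitaryRep G H) (μ : Measure G) (d : ℝ) : Prop :=
  0 < d ∧ ∀ f₁ f₂ g₁ g₂ : H,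
    Integrable (fun x => inner ℂ (π x g₁) f₁ * inner ℂ f₂ (π x g₂)) μ ∧
    ∫ x, inner ℂ (π x g₁) f₁ * inner ℂ f₂ (π x g₂) ∂μ
      = (d : ℂ)⁻¹ * inner ℂ f₂ f₁ * starRingEnd ℂ (inner ℂ g₂ g₁)

/-- The formal degree `d_π`: the number satisfying the orthogonality relations. Such a number
exists, and is unique, for every irreducible square-integrable representation of a unimodular
group; that is not built into the definition. -/
def formalDegree (π : ProjUnitaryRep G H) (μ : Measure G) : ℝ :=
  Classical.epsilon fun d : ℝ => π.IsFormalDegree μ d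

/-- The space `B¹_π` of all `g` with `V_g g ∈ W^L(L¹)`, where `W^L(L¹)` is built with the unit
neighbourhood `Q`. -/
def B1 [TopologicalSpace G] (π : ProjUnitaryRep G H) (μ : Measure G) (Q : Set G) : Set H :=
  {g | MemWienerL1 μ Q (π.coeff g g)}

end ProjUnitaryRep

/-- `(v i)` is a frame: `A ‖f‖² ≤ ∑ |⟨f, v i⟩|² ≤ B ‖f‖²` for all `f`, with `A, B > 0`. -/
def IsHilbertFrame {ι : Type*} {H : Type*} [NormedAddCommGroup H] [InnerProductSpace ℂ H]
    (v : ι → H) : Prop :=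
  ∃ A B : ℝ, 0 < A ∧ 0 < B ∧ ∀ f : H,
    Summable (fun i => ‖inner ℂ (v i) f‖ ^ 2) ∧
    A * ‖f‖ ^ 2 ≤ ∑' i, ‖inner ℂ (v i) f‖ ^ 2 ∧
    ∑' i, ‖inner ℂ (v i) f‖ ^ 2 ≤ B * ‖f‖ ^ 2

end

/-! Let `S` be the frame operator. The Gram diagonal `⟨S⁻¹ π(λ)g, π(λ)g⟩` measures how indispensable
`π(λ)g` is, and its average over `Λ` is about `d_π / D⁻(Λ) < 1`. To see this, sum `⟨π(y)g,
S⁻¹π(λ)g⟩⟨π(λ)g, π(y)g⟩` over `λ ∈ xKₙ` and integrate over `y ∈ G`. The orthogonality relations turn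
the integral into `d_π⁻¹ ‖g‖²` times the sum of the diagonal. Up to boundary effects, negligible for
a strong Følner sequence, the integrand is the full expansion `‖g‖²` for `y ∈ xKₙ` and `0`
otherwise, so the diagonal sums to about `d_π μ(Kₙ)`, while there are more than `r μ(Kₙ)` points for
some `r > d_π`. With `d_π/r < α < 1`, every translate of some `Kₙ` therefore contains a point whose
diagonal entry is at most `α` (`exists_forall_exists_mem_smul`).

A maximal `C`-separated set `Γ` of such points, with `C` a large compact set, is still relatively
dense, so it has positive density. Its Gram block has diagonal at most `α` and small off-diagonal
row sums. Hence the coefficients of `f` on `Γ` are controlled by those on `Λ \ Γ`, and the latter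
give a lower frame bound (`exists_lower_bound_compl`).

Off-diagonal decay of `S⁻¹` itself would require an inverse-closedness theorem. It is avoided by
replacing `S⁻¹` with a partial Neumann sum `R`, for which `‖1 - R S‖ ≤ δ`. Since `R` is a polynomial
in `S`, it inherits the localisation that `g ∈ B¹` gives the Gram matrix (`exists_approx_inverse`,
`IsLocalizedOp.mul_frameOperator`).

Two supporting facts are also proved: the formal degree exists, and the lower density of a
relatively separated set does not depend on the strong Følner sequence. -/

/-! ### Unimodular groups and relatively separated sets -/

section Counting

variable {G : Type*} [Group G]

theorem encard_inter_eq_tsum {α : Type*} (Λ s : Set α) :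
    ((Λ ∩ s).encard : ℝ≥0∞) = ∑' l : Λ, s.indicator (fun _ => (1 : ℝ≥0∞)) (l : α) := by
  rw [← ENNReal.tsum_set_one, tsum_subtype (Λ ∩ s) (fun _ => (1 : ℝ≥0∞)), tsum_subtype]
  congr 1 with a
  by_cases h1 : a ∈ Λ <;> by_cases h2 : a ∈ s <;> simp [h1, h2]

variable {Q : Set G}

theorem mem_smul_iff_mem_smul_of_inv_eq (hQs : Q⁻¹ = Q) (x y : G) : x ∈ y • Q ↔ y ∈ x • Q := by
  rw [Set.mem_smul_set_iff_inv_smul_mem, Set.mem_smul_set_iff_inv_smul_mem, ← Set.inv_mem_inv, hQs]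
  simp

variable [TopologicalSpace G] [IsTopologicalGroup G] [SecondCountableTopology G]

theorem countable_of_encard_inter_smul_le (hQ1 : Q ∈ 𝓝 (1 : G)) {Λ : Set G} {N : ℝ≥0∞}
    (hN : N ≠ ∞) (hΛ : ∀ x : G, ((Λ ∩ x • Q).encard : ℝ≥0∞) ≤ N) : Λ.Countable := by
  obtain ⟨t, ht, hcov⟩ := TopologicalSpace.countable_cover_nhds (f := fun x : G => x • Q)
    (fun x => by simpa using smul_mem_nhds_smul x hQ1)
  have : Λ ⊆ ⋃ x ∈ t, Λ ∩ x • Q := by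
    intro l hl
    have : l ∈ ⋃ x ∈ t, x • Q := hcov ▸ Set.mem_univ l
    simp only [Set.mem_iUnion, Set.mem_inter_iff] at this ⊢
    obtain ⟨x, hx, h⟩ := this
    exact ⟨x, hx, hl, h⟩
  refine (ht.biUnion fun x _ => Set.Finite.countable ?_).mono this
  rw [← Set.encard_lt_top_iff, ← ENat.toENNReal_lt, ENat.toENNReal_top]
  exact (hΛ x).trans_lt hN.lt_top

variable [MeasurableSpace G] [BorelSpace G] (μ : Measure G)

/-- Sums over a relatively separated set are dominated by integrals. -/
theorem tsum_lintegral_smul_le (hQs : Q⁻¹ = Q) (hQ1 : Q ∈ 𝓝 (1 : G))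
    {Λ : Set G} {N : ℝ≥0∞} (hN : N ≠ ∞) (hΛ : ∀ x : G, ((Λ ∩ x • Q).encard : ℝ≥0∞) ≤ N)
    {V : Set G} (hVQ : V ⊆ Q) (hV : MeasurableSet V) {F : G → ℝ≥0∞} (hF : AEMeasurable F μ)
    (y : G) :
    ∑' l : Λ, ∫⁻ w in (y⁻¹ * (l : G)) • V, F w ∂μ ≤ N * ∫⁻ w, F w ∂μ := by
  have : Countable Λ := (countable_of_encard_inter_smul_le hQ1 hN hΛ).to_subtype
  have hms : ∀ z : G, MeasurableSet (z • V) := fun z => hV.const_smul z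
  simp_rw [← lintegral_indicator (hms _)]
  rw [← lintegral_tsum (fun l => hF.indicator (hms _))]
  rw [← lintegral_const_mul' _ _ hN]
  refine lintegral_mono fun w => ?_
  -- After exchanging sum and integral, it suffices to count the sets containing a fixed `w`.
  -- Symmetry of `Q` places every such `l` in `(y * w) • Q`, so there are at most `N` of them.
  calc ∑' l : Λ, ((y⁻¹ * (l : G)) • V).indicator F w
      ≤ ∑' l : Λ, ((y * w) • Q).indicator (fun _ => (1 : ℝ≥0∞)) (l : G) * F w := by
        refine ENNReal.tsum_le_tsum fun l => ?_
        by_cases h : w ∈ (y⁻¹ * (l : G)) • V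
        · have : (l : G) ∈ (y * w) • Q := by
            rw [mem_smul_iff_mem_smul_of_inv_eq hQs]
            have h' := Set.smul_set_mono hVQ h
            rw [Set.mem_smul_set_iff_inv_smul_mem] at h' ⊢
            simpa [mul_assoc] using h'
          simp [h, this]
        · simp [h]
    _ = ((Λ ∩ (y * w) • Q).encard : ℝ≥0∞) * F w := by
        rw [ENNReal.tsum_mul_right, encard_inter_eq_tsum]
    _ ≤ N * F w := by gcongr; exact hΛ _

variable [T2Space G] [LocallyCompactSpace G] [μ.IsHaarMeasure]

theorem regular_of_isHaarMeasure_of_secondCountable : μ.Regular := by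
  let := TopologicalSpace.metrizableSpaceMetric G
  infer_instance

/-- A bi-invariant Haar measure is invariant under inversion. -/
theorem isInvInvariant_of_isMulRightInvariant [μ.IsMulRightInvariant] : μ.IsInvInvariant := by
  have := regular_of_isHaarMeasure_of_secondCountable μ
  have : μ.inv.Regular := Measure.Regular.map (Homeomorph.inv G)
  constructor
  -- By uniqueness of Haar measure, inversion rescales `μ` by a constant. Inverting twice gives `c ^
  -- 2 = 1`.
  let c : ℝ≥0∞ := Measure.haarScalarFactor μ.inv μ
  have hc : μ.inv = c • μ := Measure.isMulLeftInvariant_eq_smul_of_regular μ.inv μ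
  have : Measure.map Inv.inv (Measure.map Inv.inv μ) = c ^ 2 • μ := by
    rw [← Measure.inv_def μ, hc, Measure.map_smul, ← Measure.inv_def μ, hc, smul_smul, pow_two]
  have μeq : μ = c ^ 2 • μ := by
    rw [Measure.map_map continuous_inv.measurable continuous_inv.measurable] at this
    simpa only [inv_involutive, Function.Involutive.comp_self, Measure.map_id]
  have K : TopologicalSpace.PositiveCompacts G := Classical.arbitrary _
  have : c ^ 2 * μ K = 1 ^ 2 * μ K := by
    conv_rhs => rw [μeq]
    simp
  have : c ^ 2 = 1 ^ 2 :=
    (ENNReal.mul_left_inj (Measure.measure_pos_of_nonempty_interior _ K.interior_nonempty).ne'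
          K.isCompact.measure_lt_top.ne).1 this
  have : c = 1 := (ENNReal.pow_right_strictMono two_ne_zero).injective this
  rw [hc, this, one_smul]

/-- A packing bound: the translates `l • Q` with `l ∈ Λ ∩ E` all lie in `E * Q` and overlap at most
`N` times. Passing to `toMeasurable` allows arbitrary `E`. -/
theorem encard_inter_mul_measure_le (hQc : IsCompact Q) (hQs : Q⁻¹ = Q) (hQ1 : Q ∈ 𝓝 (1 : G))
    {Λ : Set G} {N : ℝ≥0∞} (hN : N ≠ ∞) (hΛ : ∀ x : G, ((Λ ∩ x • Q).encard : ℝ≥0∞) ≤ N)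
    (E : Set G) : ((Λ ∩ E).encard : ℝ≥0∞) * μ Q ≤ N * μ (E * Q) := by
  have hQm : MeasurableSet Q := hQc.isClosed.measurableSet
  set M := toMeasurable μ (E * Q)
  have hM : MeasurableSet M := measurableSet_toMeasurable _ _
  calc ((Λ ∩ E).encard : ℝ≥0∞) * μ Q
      = ∑' l : Λ, E.indicator (fun _ => (1 : ℝ≥0∞)) (l : G) * μ Q := by
        rw [encard_inter_eq_tsum, ENNReal.tsum_mul_right]
    _ ≤ ∑' l : Λ, ∫⁻ w in ((1 : G)⁻¹ * (l : G)) • Q, M.indicator (fun _ => 1) w ∂μ := by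
        refine ENNReal.tsum_le_tsum fun l => ?_
        by_cases h : (l : G) ∈ E
        · have hsub : (l : G) • Q ⊆ M := by
            refine subset_trans ?_ (subset_toMeasurable μ (E * Q))
            rintro _ ⟨q, hq, rfl⟩
            exact Set.mul_mem_mul h hq
          have : (1 : G)⁻¹ * (l : G) = l := by simp
          rw [this, lintegral_indicator hM, Measure.restrict_restrict hM,
            Set.inter_eq_self_of_subset_right hsub]
          simp [h, measure_smul]
        · simp [h]
    _ ≤ N * ∫⁻ w, M.indicator (fun _ => 1) w ∂μ :=
        tsum_lintegral_smul_le μ hQs hQ1 hN hΛ subset_rfl hQm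
          (aemeasurable_const.indicator hM) 1
    _ = N * μ (E * Q) := by
        rw [lintegral_indicator hM]; simp [M]

/-- Comparing the counting function on a compact set `C` with that on a translate of `F`. -/
theorem minRelativeCount_mul_measure_le [μ.IsMulRightInvariant] {Λ : Set G} (hc : Λ.Countable)
    {C F : Set G} (hC : IsCompact C) (hC0 : μ C ≠ 0) (x : G) :
    minRelativeCount μ Λ C * μ F ≤ ((Λ ∩ x • (F * C)).encard : ℝ≥0∞) := by
  have := isInvInvariant_of_isMulRightInvariant μ
  have : Countable Λ := hc.to_subtype
  have hCt : μ C ≠ ∞ := hC.measure_lt_top.ne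
  have hCm : MeasurableSet C := hC.isClosed.measurableSet
  have hmem : ∀ l y : G, l ∈ y • C ↔ y ∈ l • C⁻¹ := fun l y => by
    rw [Set.mem_smul_set_iff_inv_smul_mem, Set.mem_smul_set_iff_inv_smul_mem, Set.mem_inv]
    simp
  -- Double counting of the pairs `(l, y)` with `l ∈ y • C` and `y ∈ x • F`: `h1` bounds the count
  -- below over `y`, and `h2` bounds it above over `l`. The latter uses `μ C⁻¹ = μ C`, hence
  -- unimodularity.
  have h1 : minRelativeCount μ Λ C * μ F * μ C
      ≤ ∫⁻ y in x • F, ((Λ ∩ y • C).encard : ℝ≥0∞) ∂μ := by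
    calc minRelativeCount μ Λ C * μ F * μ C
        = ∫⁻ y in x • F, minRelativeCount μ Λ C * μ C ∂μ := by
          rw [lintegral_const, Measure.restrict_apply_univ, measure_smul]; ring
      _ ≤ _ := by
          refine lintegral_mono fun y => ?_
          refine (mul_le_mul_left (iInf_le _ y) _).trans ?_
          rw [ENNReal.div_mul_cancel hC0 hCt]
  have h2 : ∫⁻ y in x • F, ((Λ ∩ y • C).encard : ℝ≥0∞) ∂μ
      ≤ ((Λ ∩ x • (F * C)).encard : ℝ≥0∞) * μ C := by
    have : ∀ y, ((Λ ∩ y • C).encard : ℝ≥0∞)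
        = ∑' l : Λ, ((l : G) • C⁻¹).indicator (fun _ => (1 : ℝ≥0∞)) y := fun y => by
      rw [encard_inter_eq_tsum]
      congr 1 with l
      by_cases h : (l : G) ∈ y • C
      · simp [h, (hmem _ _).1 h]
      · simp [h, mt (hmem _ _).2 h]
    simp_rw [this]
    have hm : ∀ l : G, MeasurableSet (l • C⁻¹) := fun l => hCm.inv.const_smul l
    rw [lintegral_tsum fun l => (measurable_const.indicator (hm _)).aemeasurable]
    rw [encard_inter_eq_tsum, ← ENNReal.tsum_mul_right]
    refine ENNReal.tsum_le_tsum fun l => ?_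
    rw [lintegral_indicator (hm _), Measure.restrict_restrict (hm _), lintegral_const, one_mul,
      Measure.restrict_apply_univ]
    by_cases h : (l : G) ∈ x • (F * C)
    · rw [Set.indicator_of_mem h, one_mul]
      refine (measure_mono Set.inter_subset_left).trans ?_
      rw [measure_smul, Measure.measure_inv]
    · have : (l : G) • C⁻¹ ∩ x • F = ∅ := by
        rw [Set.eq_empty_iff_forall_notMem]
        rintro y ⟨hy, f, hf, rfl⟩
        rw [← hmem] at hy
        obtain ⟨c, hc, hl⟩ := hy
        refine h ⟨f * c, Set.mul_mem_mul hf hc, ?_⟩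
        simpa [mul_assoc] using hl
      simp [this]
  exact (ENNReal.mul_le_mul_iff_left hC0 hCt).1 (h1.trans h2)

/-- The lower Beurling density of a relatively separated set exists and does not depend on the
strong Følner sequence. -/
theorem hasLowerBeurlingDensity_iSup [μ.IsMulRightInvariant] (hQc : IsCompact Q) (hQs : Q⁻¹ = Q)
    (hQ1 : Q ∈ 𝓝 (1 : G)) {Λ : Set G} {N : ℝ≥0∞} (hN : N ≠ ∞)
    (hΛ : ∀ x : G, ((Λ ∩ x • Q).encard : ℝ≥0∞) ≤ N) :
    HasLowerBeurlingDensity μ Λ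
      (⨆ (C : Set G) (_ : IsCompact C) (_ : μ C ≠ 0), minRelativeCount μ Λ C) := by
  intro F hF
  have hQ0 : μ Q ≠ 0 := (Measure.measure_pos_of_mem_nhds μ hQ1).ne'
  have hQt : μ Q ≠ ∞ := hQc.measure_lt_top.ne
  have hcount := countable_of_encard_inter_smul_le hQ1 hN hΛ
  refine tendsto_of_le_liminf_of_limsup_le ?_ ?_
  · refine iSup_le fun C => iSup_le fun hC => iSup_le fun hC0 => ?_
    -- Both pieces are needed: a point of `((F n * C) \ F n) * Q` lies in `F n * (C * Q)` and in `(F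
    -- n)ᶜ * Q`, hence in the `D`-boundary of `F n`.
    set D := C * Q ∪ Q
    have hD : IsCompact D := (hC.mul hQc).union hQc
    -- Double counting compares `C` with `F n * C`. The surplus points in `(F n * C) \ F n` are few
    -- by the packing bound, because the boundary of `F n` is small.
    have key : ∀ n, minRelativeCount μ Λ C ≤ minRelativeCount μ Λ (F n)
        + N / μ Q * (μ ((F n * D) ∩ ((F n)ᶜ * D)) / μ (F n)) := by
      intro n
      have h0 := hF.measure_ne_zero n
      have ht : μ (F n) ≠ ∞ := (hF.isCompact n).measure_lt_top.ne
      conv_rhs => rw [minRelativeCount, ENNReal.iInf_add]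
      refine le_iInf fun x => ?_
      have hsub : Λ ∩ x • (F n * C) ⊆ (Λ ∩ x • F n) ∪ (Λ ∩ x • ((F n * C) \ F n)) := by
        rw [← Set.inter_union_distrib_left, ← Set.smul_set_union]
        refine Set.inter_subset_inter_right _ (Set.smul_set_mono fun z hz => ?_)
        by_cases h : z ∈ F n
        · exact Or.inl h
        · exact Or.inr ⟨hz, h⟩
      have h3 : ((Λ ∩ x • (F n * C)).encard : ℝ≥0∞) ≤ ((Λ ∩ x • F n).encard : ℝ≥0∞)
          + ((Λ ∩ x • ((F n * C) \ F n)).encard : ℝ≥0∞) := by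
        rw [← ENat.toENNReal_add, ENat.toENNReal_le]
        exact (Set.encard_le_encard hsub).trans (Set.encard_union_le _ _)
      have h4 : ((Λ ∩ x • ((F n * C) \ F n)).encard : ℝ≥0∞)
          ≤ N / μ Q * μ ((F n * D) ∩ ((F n)ᶜ * D)) := by
        have := encard_inter_mul_measure_le μ hQc hQs hQ1 hN hΛ (x • ((F n * C) \ F n))
        rw [smul_mul_assoc, measure_smul] at this
        have h5 : ((F n * C) \ F n) * Q ⊆ (F n * D) ∩ ((F n)ᶜ * D) := by
          rintro _ ⟨a, ⟨ha1, ha2⟩, q, hq, rfl⟩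
          refine ⟨?_, Set.mul_mem_mul ha2 (Or.inr hq)⟩
          obtain ⟨f, hf, c, hc, rfl⟩ := ha1
          simp only [mul_assoc]
          exact Set.mul_mem_mul hf (Or.inl (Set.mul_mem_mul hc hq))
        have h6 := this.trans (mul_le_mul_right (measure_mono h5) N)
        rw [← ENNReal.le_div_iff_mul_le (Or.inl hQ0) (Or.inl hQt)] at h6
        refine h6.trans (le_of_eq ?_)
        rw [div_eq_mul_inv, div_eq_mul_inv]; ring
      have h7 := (minRelativeCount_mul_measure_le μ hcount hC hC0 x).trans
        (h3.trans (add_le_add_right h4 _))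
      rw [← ENNReal.le_div_iff_mul_le (Or.inl h0) (Or.inl ht)] at h7
      refine h7.trans (le_of_eq ?_)
      rw [ENNReal.add_div, mul_div_assoc]
    have hlim : Tendsto (fun n => N / μ Q * (μ ((F n * D) ∩ ((F n)ᶜ * D)) / μ (F n)))
        atTop (𝓝 0) := by
      have := ENNReal.Tendsto.const_mul (a := N / μ Q) (hF.tendsto_boundary D hD)
        (Or.inr (ENNReal.div_ne_top hN hQ0))
      simpa using this
    refine le_of_forall_lt fun a ha => ?_
    obtain ⟨b, hab, hb⟩ := exists_between ha
    have hev : ∀ᶠ n in atTop, b ≤ minRelativeCount μ Λ (F n) := by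
      filter_upwards [hlim.eventually_lt_const (tsub_pos_of_lt hb)] with n hn
      by_contra! hlt
      exact (key n).not_gt ((add_le_add_left hlt.le _).trans_lt (lt_tsub_iff_left.1 hn))
    exact hab.trans_le (le_liminf_of_le (by isBoundedDefault) hev)
  -- The upper bound is immediate, since each `F n` is itself a competitor in the supremum.
  · refine limsup_le_of_le (by isBoundedDefault) (Eventually.of_forall fun n => ?_)
    exact le_iSup_of_le (F n) (le_iSup_of_le (hF.isCompact n)
      (le_iSup_of_le (hF.measure_ne_zero n) le_rfl))

end Counting

/-! ### Orthogonality relations -/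

namespace ProjUnitaryRep

section Algebra

variable {G : Type*} [Group G] [MeasurableSpace G]
  {H : Type*} [NormedAddCommGroup H] [InnerProductSpace ℂ H] (π : ProjUnitaryRep G H)

theorem exists_map_mul (x y : G) :
    ∃ c : Circle, ∀ f : H, π (x * y) f = (c : ℂ) • π x (π y f) := by
  obtain ⟨σ, hσ⟩ := π.exists_cocycle
  exact ⟨σ x y, fun f => hσ x y f⟩

theorem exists_map_one : ∃ c : Circle, ∀ f : H, π 1 f = (c : ℂ) • f := by
  obtain ⟨c, hc⟩ := π.exists_map_mul 1 1
  refine ⟨c⁻¹, fun f => ?_⟩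
  have h := hc f
  rw [mul_one, ← map_smul] at h
  have h' := (π 1).injective h
  conv_rhs => rw [h', smul_smul]
  simp

theorem exists_map_inv (x : G) :
    ∃ c : Circle, ∀ f : H, (π x).symm f = (c : ℂ) • π x⁻¹ f := by
  obtain ⟨c, hc⟩ := π.exists_map_mul x x⁻¹
  obtain ⟨e, he⟩ := π.exists_map_one
  refine ⟨e⁻¹ * c, fun f => ?_⟩
  rw [LinearIsometryEquiv.symm_apply_eq, map_smul]
  have h := hc f
  rw [mul_inv_cancel, he] at h
  rw [Circle.coe_mul, ← smul_smul, ← h, smul_smul]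
  simp

theorem norm_inner_map_map (x y : G) (f h : H) :
    ‖inner ℂ (π x f) (π y h)‖ = ‖inner ℂ f (π (x⁻¹ * y) h)‖ := by
  obtain ⟨c, hc⟩ := π.exists_map_mul x (x⁻¹ * y)
  have := hc h
  rw [mul_inv_cancel_left] at this
  rw [this, inner_smul_right, LinearIsometryEquiv.inner_map_map, norm_mul,
    Circle.norm_coe, one_mul]

theorem norm_coeff_swap (g f : H) (x : G) : ‖π.coeff g f x‖ = ‖π.coeff f g x⁻¹‖ := by
  obtain ⟨c, hc⟩ := π.exists_map_inv x
  have h := (π x).inner_map_map g ((π x).symm f)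
  rw [LinearIsometryEquiv.apply_symm_apply, hc] at h
  rw [coeff, h, coeff, inner_smul_right, norm_mul, Circle.norm_coe, one_mul, norm_inner_symm]

theorem norm_coeff_map (g f : H) (y x : G) :
    ‖π.coeff g (π y f) x‖ = ‖π.coeff g f (y⁻¹ * x)‖ := by
  rw [coeff, norm_inner_symm, norm_inner_map_map, coeff, norm_inner_symm]

theorem norm_coeff_le (g f : H) (x : G) : ‖π.coeff g f x‖ ≤ ‖g‖ * ‖f‖ := by
  simpa [coeff] using norm_inner_le_norm (𝕜 := ℂ) (π x g) f

theorem stronglyMeasurable_coeff (g f : H) : StronglyMeasurable (π.coeff g f) :=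
  (π.stronglyMeasurable g).inner stronglyMeasurable_const

/-- Schur's lemma for self-adjoint operators. -/
theorem IsIrreducible.exists_eq_smul_one [CompleteSpace H] {π : ProjUnitaryRep G H}
    (hπ : π.IsIrreducible) {A : H →L[ℂ] H} (hA : IsSelfAdjoint A)
    (hcomm : ∀ x f, A (π x f) = π x (A f)) : ∃ c : ℝ, A = c • (1 : H →L[ℂ] H) := by
  by_cases hsub : (spectrum ℝ A).Subsingleton
  · obtain h0 | ⟨c, hc⟩ := hsub.eq_empty_or_singleton
    · refine ⟨0, ?_⟩
      simpa [Algebra.algebraMap_eq_smul_one] using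
        CFC.eq_algebraMap_of_spectrum_subset_singleton A (0 : ℝ) (by simp [h0]) hA
    · refine ⟨c, ?_⟩
      simpa [Algebra.algebraMap_eq_smul_one] using
        CFC.eq_algebraMap_of_spectrum_subset_singleton A c (by simp [hc]) hA
  · exfalso
    rw [Set.not_subsingleton_iff] at hsub
    obtain ⟨a, ha, b, hb, hab⟩ := hsub.exists_lt
    obtain ⟨m, ham, hmb⟩ := exists_between hab
    -- If the spectrum had two points, these functions with disjoint supports, one seeing `a` and
    -- the other `b`, would give nonzero operators with product zero. The kernel of `cfc p A` would
    -- then be a closed invariant subspace that is neither zero nor everything.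
    set p : ℝ → ℝ := fun t => max 0 (m - t)
    set q : ℝ → ℝ := fun t => max 0 (t - m)
    have hp : Continuous p := by fun_prop
    have hq : Continuous q := by fun_prop
    have hpq : cfc p A * cfc q A = 0 := by
      rw [← cfc_mul p q A hp.continuousOn hq.continuousOn]
      have : (fun x => p x * q x) = fun _ => 0 := by
        funext t
        rcases le_total m t with h | h
        · simp [p, h]
        · simp [q, h]
      rw [this, cfc_const_zero]
    have hne : ∀ r : ℝ → ℝ, Continuous r → ∀ t ∈ spectrum ℝ A, r t ≠ 0 → cfc r A ≠ 0 := by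
      intro r hr t ht hrt h0
      have : cfc r A = cfc (fun _ : ℝ => (0 : ℝ)) A := by rw [h0, cfc_const_zero]
      exact hrt (eqOn_of_cfc_eq_cfc this hr.continuousOn continuousOn_const hA ht)
    have hp0 : cfc p A ≠ 0 := hne p hp a ha (by simp [p, ham])
    have hq0 : cfc q A ≠ 0 := hne q hq b hb (by simp [q, hmb])
    have hinv : ∀ x : G, ∀ f ∈ (cfc p A).ker, π x f ∈ (cfc p A).ker := by
      intro x f hf
      let U : H →L[ℂ] H := (π x : H ≃L[ℂ] H)
      have hU : Commute A U := by
        ext f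
        exact hcomm x f
      have h2 := DFunLike.congr_fun (hU.cfc_real p) f
      rw [LinearMap.mem_ker] at hf ⊢
      have h3 : cfc p A (π x f) = π x (cfc p A f) := h2
      have hf' : cfc p A f = 0 := hf
      exact h3.trans (by rw [hf', map_zero])
    rcases hπ (cfc p A).ker (cfc p A).isClosed_ker hinv with h | h
    · apply hq0
      ext f
      have h1 := DFunLike.congr_fun hpq f
      have : cfc q A f ∈ (cfc p A).ker := h1
      rw [h] at this
      simpa using this
    · apply hp0
      ext f
      have : f ∈ (cfc p A).ker := h ▸ Submodule.mem_top
      exact this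

end Algebra

end ProjUnitaryRep

namespace ProjUnitaryRep

section Graph

variable {G : Type*} [Group G] [MeasurableSpace G]
  {H : Type*} [NormedAddCommGroup H] [InnerProductSpace ℂ H] (π : ProjUnitaryRep G H)

/-- The graph of the (possibly unbounded) operator `f ↦ V_g f` from `H` to `L²(G)`. -/
noncomputable def coeffGraph (μ : Measure G) (g : H) : Submodule ℂ (WithLp 2 (H × Lp ℂ 2 μ)) where
  carrier := {p | p.snd =ᵐ[μ] π.coeff g p.fst}
  add_mem' {p q} hp hq := by
    filter_upwards [hp, hq, Lp.coeFn_add p.snd q.snd] with x h1 h2 h3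
    simp only [WithLp.add_snd, WithLp.add_fst, coeff, inner_add_right] at h1 h2 h3 ⊢
    rw [h3, Pi.add_apply, h1, h2]
  zero_mem' := by
    filter_upwards [Lp.coeFn_zero ℂ 2 μ] with x h1
    simpa [coeff] using h1
  smul_mem' c p hp := by
    filter_upwards [hp, Lp.coeFn_smul c p.snd] with x h1 h2
    simp only [WithLp.smul_snd, WithLp.smul_fst, coeff, inner_smul_right] at h1 h2 ⊢
    rw [h2, Pi.smul_apply, h1, smul_eq_mul]

/-- An `L²`-limit is an a.e. limit along a subsequence, while `V_g f` depends continuously on `f` at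
every point. Closedness makes the graph a Hilbert space, so adjoints are available even though `V_g`
may be unbounded. -/
theorem isClosed_coeffGraph (μ : Measure G) (g : H) :
    IsClosed (π.coeffGraph μ g : Set (WithLp 2 (H × Lp ℂ 2 μ))) := by
  refine IsSeqClosed.isClosed fun p q hp hlim => ?_
  have h1 : Tendsto (fun n => (p n).fst) atTop (𝓝 q.fst) :=
    ((WithLp.fstL 2 ℂ H (Lp ℂ 2 μ)).continuous.tendsto q).comp hlim
  have h2 : Tendsto (fun n => (p n).snd) atTop (𝓝 q.snd) :=
    ((WithLp.sndL 2 ℂ H (Lp ℂ 2 μ)).continuous.tendsto q).comp hlim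
  obtain ⟨ns, hns, hae⟩ := (tendstoInMeasure_of_tendsto_Lp h2).exists_seq_tendsto_ae
  have hall : ∀ᵐ x ∂μ, ∀ n, (p n).snd x = π.coeff g (p n).fst x :=
    ae_all_iff.2 fun n => hp n
  change q.snd =ᵐ[μ] π.coeff g q.fst
  filter_upwards [hae, hall] with x hx hx'
  have h3 : Tendsto (fun n => π.coeff g (p (ns n)).fst x) atTop (𝓝 (π.coeff g q.fst x)) :=
    (tendsto_const_nhds.inner h1).comp hns.tendsto_atTop
  simp_rw [← hx'] at h3
  exact tendsto_nhds_unique hx h3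

/-- The element of the graph lying above a vector `f` with `V_g f ∈ L²(G)`. -/
noncomputable def coeffGraphMk {μ : Measure G} {g f : H} (hf : MemLp (π.coeff g f) 2 μ) :
    π.coeffGraph μ g :=
  ⟨WithLp.toLp 2 (f, hf.toLp _), hf.coeFn_toLp⟩

theorem memLp_coeff_of_mem {μ : Measure G} {g : H} (p : π.coeffGraph μ g) :
    MemLp (π.coeff g (p : WithLp 2 (H × Lp ℂ 2 μ)).fst) 2 μ :=
  (memLp_congr_ae p.2).1 (Lp.memLp _)

theorem inner_coeffGraph {μ : Measure G} {g : H} (p q : π.coeffGraph μ g) :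
    inner ℂ p q = inner ℂ (p : WithLp 2 (H × Lp ℂ 2 μ)).fst (q : WithLp 2 (H × Lp ℂ 2 μ)).fst
      + ∫ x, inner ℂ (π.coeff g (p : WithLp 2 (H × Lp ℂ 2 μ)).fst x)
          (π.coeff g (q : WithLp 2 (H × Lp ℂ 2 μ)).fst x) ∂μ := by
  rw [Submodule.coe_inner, WithLp.prod_inner_apply, L2.inner_def]
  congr 1
  refine integral_congr_ae ?_
  filter_upwards [p.2, q.2] with x h1 h2
  rw [← h1, ← h2]
  rfl

variable [MeasurableMul G]

theorem memLp_coeff_map {μ : Measure G} [μ.IsMulLeftInvariant] {g f : H}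
    (hf : MemLp (π.coeff g f) 2 μ) (y : G) : MemLp (π.coeff g (π y f)) 2 μ := by
  have := hf.comp_measurePreserving (measurePreserving_mul_left μ y⁻¹)
  exact this.congr_norm (π.stronglyMeasurable_coeff g _).aestronglyMeasurable
    (Eventually.of_forall fun x => (π.norm_coeff_map g f y x).symm)

theorem memLp_coeff_symm {μ : Measure G} [μ.IsMulLeftInvariant] {g f : H}
    (hf : MemLp (π.coeff g f) 2 μ) (y : G) : MemLp (π.coeff g ((π y).symm f)) 2 μ := by
  obtain ⟨c, hc⟩ := π.exists_map_inv y
  refine (π.memLp_coeff_map hf y⁻¹).congr_norm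
    (π.stronglyMeasurable_coeff g _).aestronglyMeasurable (Eventually.of_forall fun x => ?_)
  rw [hc, coeff, coeff, inner_smul_right, norm_mul, Circle.norm_coe, one_mul]

/-- Translating by `y` multiplies both coefficients by the same unimodular factor, which cancels in
the sesquilinear integrand. -/
theorem integral_inner_coeff_map (μ : Measure G) [μ.IsMulLeftInvariant] (g f h : H) (y : G) :
    ∫ x, inner ℂ (π.coeff g (π y f) x) (π.coeff g (π y h) x) ∂μ
      = ∫ x, inner ℂ (π.coeff g f x) (π.coeff g h x) ∂μ := by
  rw [← integral_mul_left_eq_self (μ := μ)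
    (fun x => inner ℂ (π.coeff g (π y f) x) (π.coeff g (π y h) x)) y]
  refine integral_congr_ae (Eventually.of_forall fun x => ?_)
  obtain ⟨c, hc⟩ := π.exists_map_mul y x
  have hphase : ∀ k : H, π.coeff g (π y k) (y * x) = (starRingEnd ℂ) (c : ℂ) * π.coeff g k x := by
    intro k
    rw [coeff, hc, inner_smul_left, LinearIsometryEquiv.inner_map_map, coeff]
  have hcc : (c : ℂ) * (starRingEnd ℂ) (c : ℂ) = 1 := by
    rw [Complex.mul_conj, Circle.normSq_coe, Complex.ofReal_one]
  simp only [hphase, RCLike.inner_apply, map_mul, Complex.conj_conj]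
  linear_combination (π.coeff g h x * (starRingEnd ℂ) (π.coeff g f x)) * hcc

/-- If `V_g f₀ ∈ L²(G)` for one non-zero `f₀`, then `f ↦ V_g f` is a multiple of an isometry. -/
theorem IsIrreducible.exists_integral_norm_sq_coeff [CompleteSpace H] {π : ProjUnitaryRep G H}
    (hπ : π.IsIrreducible) {μ : Measure G} [μ.IsMulLeftInvariant] {g f₀ : H} (hf₀ : f₀ ≠ 0)
    (h₀ : MemLp (π.coeff g f₀) 2 μ) :
    ∃ C : ℝ, ∀ f : H, MemLp (π.coeff g f) 2 μ ∧ ∫ x, ‖π.coeff g f x‖ ^ 2 ∂μ = C * ‖f‖ ^ 2 := by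
  have : CompleteSpace (π.coeffGraph μ g) := (π.isClosed_coeffGraph μ g).completeSpace_coe
  let ι : π.coeffGraph μ g →L[ℂ] H :=
    (WithLp.fstL 2 ℂ H (Lp ℂ 2 μ)).comp (π.coeffGraph μ g).subtypeL
  have hι : ∀ p : π.coeffGraph μ g, ι p = (p : WithLp 2 (H × Lp ℂ 2 μ)).fst := fun p => rfl
  -- Formally `A` is `(1 + V_g* V_g)⁻¹`, but it is bounded with no assumption on the domain of
  -- `V_g`. It commutes with `π` because `π y` acts unitarily on the graph; Schur's lemma then makes
  -- it a scalar.
  let A : H →L[ℂ] H := ι.comp ι.adjoint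
  have hA : IsSelfAdjoint A := by
    rw [ContinuousLinearMap.isSelfAdjoint_iff']
    simp [A, ContinuousLinearMap.adjoint_comp]
  have hcomm : ∀ x f, A (π x f) = π x (A f) := by
    intro y f
    set e := ι.adjoint f
    have key : ι.adjoint (π y f)
        = π.coeffGraphMk (π.memLp_coeff_map (π.memLp_coeff_of_mem e) y) := by
      refine ext_inner_right ℂ fun w => ?_
      let w' := π.coeffGraphMk (π.memLp_coeff_symm (π.memLp_coeff_of_mem w) y)
      have hw : (w : WithLp 2 (H × Lp ℂ 2 μ)).fst
          = π y (w' : WithLp 2 (H × Lp ℂ 2 μ)).fst :=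
        ((π y).apply_symm_apply _).symm
      rw [ContinuousLinearMap.adjoint_inner_left, inner_coeffGraph, hι, hw,
        LinearIsometryEquiv.inner_map_map]
      change _ = inner ℂ (π y (e : WithLp 2 (H × Lp ℂ 2 μ)).fst)
        (π y (w' : WithLp 2 (H × Lp ℂ 2 μ)).fst)
        + ∫ x, inner ℂ (π.coeff g (π y (e : WithLp 2 (H × Lp ℂ 2 μ)).fst) x)
          (π.coeff g (π y (w' : WithLp 2 (H × Lp ℂ 2 μ)).fst) x) ∂μ
      rw [integral_inner_coeff_map, LinearIsometryEquiv.inner_map_map, ← inner_coeffGraph, ← hι,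
        ContinuousLinearMap.adjoint_inner_left]
    change ι (ι.adjoint (π y f)) = π y (ι e)
    rw [key]
    rfl
  obtain ⟨c, hc⟩ := hπ.exists_eq_smul_one hA hcomm
  have hc' : ∀ f, ι (ι.adjoint f) = (c : ℂ) • f := fun f => by
    have := DFunLike.congr_fun hc f
    simpa [A] using this
  have hnorm : ∀ f, ‖ι.adjoint f‖ ^ 2 = c * ‖f‖ ^ 2 := fun f => by
    have : inner ℂ (ι.adjoint f) (ι.adjoint f) = (c : ℂ) * inner ℂ f f := by
      rw [ContinuousLinearMap.adjoint_inner_left, hc', inner_smul_right]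
    rw [inner_self_eq_norm_sq_to_K (𝕜 := ℂ) (ι.adjoint f),
      inner_self_eq_norm_sq_to_K (𝕜 := ℂ) f] at this
    simp only [Complex.coe_algebraMap] at this
    exact_mod_cast this
  -- If `c = 0` then the adjoint vanishes; pairing it with the graph element above `f₀` would give
  -- `⟨f₀, f₀⟩ = 0`.
  have hc0 : c ≠ 0 := by
    rintro rfl
    have h1 : ∀ f, ι.adjoint f = 0 := fun f => by simpa using hnorm f
    have h2 := ContinuousLinearMap.adjoint_inner_left ι (π.coeffGraphMk h₀) f₀
    rw [h1, inner_zero_left] at h2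
    exact hf₀ (inner_self_eq_zero.1 h2.symm)
  have hc0' : (c : ℂ) ≠ 0 := by exact_mod_cast hc0
  have hmem : ∀ f, MemLp (π.coeff g f) 2 μ := by
    intro f
    have := π.memLp_coeff_of_mem (ι.adjoint ((c : ℂ)⁻¹ • f))
    rw [← hι, hc', smul_smul, mul_inv_cancel₀ hc0', one_smul] at this
    exact this
  -- The graph element `ι.adjoint f` lies above `c • f`. Pairing it with the one above `f` gives `c
  -- ‖f‖² + c ∫ |V_g f|² = ‖f‖²`.
  refine ⟨c⁻¹ - 1, fun f => ⟨hmem f, ?_⟩⟩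
  have h1 : inner ℂ (ι.adjoint f) (π.coeffGraphMk (hmem f)) = inner ℂ f f :=
    ContinuousLinearMap.adjoint_inner_left ι _ _
  rw [inner_coeffGraph, ← hι, hc'] at h1
  change inner ℂ ((c : ℂ) • f) f
    + ∫ x, inner ℂ (π.coeff g ((c : ℂ) • f) x) (π.coeff g f x) ∂μ = _ at h1
  have h2 : ∀ x, inner ℂ (π.coeff g ((c : ℂ) • f) x) (π.coeff g f x)
      = (c : ℂ) * ((‖π.coeff g f x‖ ^ 2 : ℝ) : ℂ) := by
    intro x
    have h3 : π.coeff g ((c : ℂ) • f) x = (c : ℂ) • π.coeff g f x := by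
      simp [coeff]
    rw [h3, inner_smul_left, Complex.conj_ofReal,
      inner_self_eq_norm_sq_to_K (𝕜 := ℂ) (π.coeff g f x), Complex.ofReal_pow]
    rfl
  simp_rw [h2] at h1
  rw [integral_const_mul, integral_complex_ofReal, inner_smul_left, Complex.conj_ofReal,
    inner_self_eq_norm_sq_to_K (𝕜 := ℂ) f] at h1
  change (c : ℂ) * ((‖f‖ : ℝ) : ℂ) ^ 2 + _ = ((‖f‖ : ℝ) : ℂ) ^ 2 at h1
  have h4 : c * ‖f‖ ^ 2 + c * ∫ x, ‖π.coeff g f x‖ ^ 2 ∂μ = ‖f‖ ^ 2 := by exact_mod_cast h1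
  field_simp
  linarith

end Graph

end ProjUnitaryRep

/-! ### Existence of the formal degree -/

namespace ProjUnitaryRep

section FormalDegree

variable {G : Type*} [Group G] [MeasurableSpace G]
  {H : Type*} [NormedAddCommGroup H] [InnerProductSpace ℂ H] (π : ProjUnitaryRep G H)

theorem memLp_two_coeff_of_integrable {μ : Measure G} {g f : H}
    (h : Integrable (π.coeff g f) μ) : MemLp (π.coeff g f) 2 μ := by
  rw [memLp_two_iff_integrable_sq_norm (π.stronglyMeasurable_coeff g f).aestronglyMeasurable]
  refine (h.norm.const_mul (‖g‖ * ‖f‖)).mono'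
    ((π.stronglyMeasurable_coeff g f).norm.pow 2).aestronglyMeasurable
    (Eventually.of_forall fun x => ?_)
  rw [norm_pow, norm_norm, pow_two]
  gcongr
  exact π.norm_coeff_le g f x

/-- The orthogonality relations on the diagonal. -/
theorem IsIntegrableRep.exists_integral_norm_sq_coeff [CompleteSpace H] [MeasurableMul G]
    [MeasurableInv G] {π : ProjUnitaryRep G H} {μ : Measure G} [μ.IsMulLeftInvariant]
    [μ.IsInvInvariant] (hπ : π.IsIntegrableRep μ) :
    ∃ κ : ℝ, ∀ f g : H, MemLp (π.coeff g f) 2 μ ∧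
      ∫ x, ‖π.coeff g f x‖ ^ 2 ∂μ = κ * (‖f‖ ^ 2 * ‖g‖ ^ 2) := by
  obtain ⟨g₀, hg₀, hint⟩ := hπ.exists_integrable_vector
  obtain ⟨C, hC⟩ := hπ.irreducible.exists_integral_norm_sq_coeff hg₀
    (π.memLp_two_coeff_of_integrable hint)
  have hswap : ∀ f : H, MemLp (π.coeff f g₀) 2 μ := fun f => by
    have h1 := (hC f).1.comp_measurePreserving (Measure.measurePreserving_inv μ)
    exact h1.congr_norm (π.stronglyMeasurable_coeff f g₀).aestronglyMeasurable
      (Eventually.of_forall fun x => (π.norm_coeff_swap f g₀ x).symm)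
  have hnorm : ‖g₀‖ ^ 2 ≠ 0 := by simpa using hg₀
  refine ⟨C / ‖g₀‖ ^ 2, fun f g => ?_⟩
  obtain ⟨D, hD⟩ := hπ.irreducible.exists_integral_norm_sq_coeff hg₀ (hswap g)
  refine ⟨(hD f).1, ?_⟩
  -- Inverting the variable exchanges the roles of the two vectors, so the constant belonging to `g`
  -- is proportional to `‖g‖ ^ 2`.
  have h1 : D * ‖g₀‖ ^ 2 = C * ‖g‖ ^ 2 := by
    rw [← (hD g₀).2, ← (hC g).2, ← integral_inv_eq_self (fun x => ‖π.coeff g g₀ x‖ ^ 2)]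
    refine integral_congr_ae (Eventually.of_forall fun x => ?_)
    simp only
    rw [π.norm_coeff_swap g g₀, inv_inv]
  rw [(hD f).2]
  field_simp
  linear_combination ‖f‖ ^ 2 * h1

/-- Some matrix coefficient does not vanish almost everywhere. -/
theorem exists_coeff_not_ae_zero {μ : Measure G} [NeZero μ] {g : H} (hg : g ≠ 0) :
    ∃ f : H, ¬ π.coeff g f =ᵐ[μ] 0 := by
  by_contra! hcon
  -- `H` need not be separable, but the orbit of `g` is. A countable set `D` suffices, and some `π x
  -- g` would be orthogonal to `D` while lying in its closure.
  obtain ⟨D, hDc, hD⟩ := (π.stronglyMeasurable g).isSeparable_range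
  have hall : ∀ᵐ x ∂μ, ∀ d ∈ D, inner ℂ (π x g) d = 0 :=
    (ae_ball_iff hDc).2 fun d _ => hcon d
  obtain ⟨x, hx⟩ := hall.exists
  have hclosed : IsClosed {v : H | inner ℂ (π x g) v = 0} :=
    isClosed_eq (by fun_prop) continuous_const
  have h1 := closure_minimal (show D ⊆ {v : H | inner ℂ (π x g) v = 0} from hx) hclosed
    (hD ⟨x, rfl⟩)
  exact hg (by simpa using h1)

/-- Polarisation: a sesquilinear form that vanishes on the diagonal vanishes. -/
theorem sesquilin_eq_zero_of_diag {E : Type*} [AddCommGroup E] [Module ℂ E]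
    (D : E → E → ℂ) (hl : ∀ x x' y, D (x + x') y = D x y + D x' y)
    (hr : ∀ x y y', D x (y + y') = D x y + D x y')
    (hIl : ∀ x y, D (Complex.I • x) y = -Complex.I * D x y)
    (hIr : ∀ x y, D x (Complex.I • y) = Complex.I * D x y) (h0 : ∀ x, D x x = 0) (x y : E) :
    D x y = 0 := by
  have h1 := h0 (x + y)
  have h2 := h0 (x + Complex.I • y)
  simp only [hl, hr, hIl, hIr, h0] at h1 h2
  linear_combination h1 / 2 - Complex.I / 2 * h2 + (D x y - D y x) / 2 * Complex.I_sq

/-- The orthogonality relations: an integrable representation of a unimodular group has a formal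
degree. -/
theorem IsIntegrableRep.exists_isFormalDegree [CompleteSpace H] [MeasurableMul G]
    [MeasurableInv G] {π : ProjUnitaryRep G H} {μ : Measure G} [NeZero μ] [μ.IsMulLeftInvariant]
    [μ.IsInvInvariant] (hπ : π.IsIntegrableRep μ) : ∃ d : ℝ, π.IsFormalDegree μ d := by
  obtain ⟨κ, hκ⟩ := hπ.exists_integral_norm_sq_coeff
  have hκ0 : 0 < κ := by
    obtain ⟨g, hg, -⟩ := hπ.exists_integrable_vector
    obtain ⟨f, hf⟩ := π.exists_coeff_not_ae_zero (μ := μ) hg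
    have hnonneg : 0 ≤ κ * (‖f‖ ^ 2 * ‖g‖ ^ 2) := by
      rw [← (hκ f g).2]
      positivity
    have hne : κ * (‖f‖ ^ 2 * ‖g‖ ^ 2) ≠ 0 := by
      rw [← (hκ f g).2]
      intro h0
      rw [integral_eq_zero_iff_of_nonneg (fun x => by positivity)
        ((memLp_two_iff_integrable_sq_norm (hκ f g).1.1).1 (hκ f g).1)] at h0
      refine hf ?_
      filter_upwards [h0] with x hx
      simpa using hx
    exact pos_of_mul_pos_left (lt_of_le_of_ne hnonneg hne.symm) (by positivity)
  have hint : ∀ f₁ f₂ g₁ g₂ : H, Integrable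
      (fun x => π.coeff g₁ f₁ x * (starRingEnd ℂ) (π.coeff g₂ f₂ x)) μ := by
    intro f₁ f₂ g₁ g₂
    exact (hκ f₁ g₁).1.integrable_mul (hκ f₂ g₂).1.star
  have hsqi : ∀ f g : H, ∫ x, ((‖π.coeff g f x‖ ^ 2 : ℝ) : ℂ) ∂μ
      = (κ : ℂ) * ((‖f‖ ^ 2 : ℝ) : ℂ) * ((‖g‖ ^ 2 : ℝ) : ℂ) := fun f g => by
    rw [integral_complex_ofReal, (hκ f g).2]
    push_cast
    ring
  have hadd : ∀ (g f f' : H) (x : G), π.coeff g (f + f') x = π.coeff g f x + π.coeff g f' x :=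
    fun g f f' x => inner_add_right _ _ _
  have hsmul : ∀ (g f : H) (c : ℂ) (x : G), π.coeff g (c • f) x = c * π.coeff g f x :=
    fun g f c x => inner_smul_right _ _ _
  have hadd' : ∀ (g g' f : H) (x : G), π.coeff (g + g') f x = π.coeff g f x + π.coeff g' f x :=
    fun g g' f x => by simp only [coeff, map_add, inner_add_left]
  have hsmul' : ∀ (g f : H) (c : ℂ) (x : G),
      π.coeff (c • g) f x = (starRingEnd ℂ) c * π.coeff g f x :=
    fun g f c x => by simp only [coeff, map_smul, inner_smul_left]
  -- The norm identity is polarised twice: here in the `f` variables with `g` fixed, then below in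
  -- the `g` variables.
  have hdiag : ∀ f₁ f₂ g : H, ∫ x, π.coeff g f₁ x * (starRingEnd ℂ) (π.coeff g f₂ x) ∂μ
      = (κ : ℂ) * inner ℂ f₂ f₁ * ((‖g‖ ^ 2 : ℝ) : ℂ) := by
    intro f₁ f₂ g
    rw [← sub_eq_zero]
    refine sesquilin_eq_zero_of_diag (fun f₂ f₁ => ∫ x, π.coeff g f₁ x
      * (starRingEnd ℂ) (π.coeff g f₂ x) ∂μ - (κ : ℂ) * inner ℂ f₂ f₁ * ((‖g‖ ^ 2 : ℝ) : ℂ))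
      (fun f f' h => ?_) (fun h f f' => ?_) (fun f h => ?_) (fun h f => ?_) (fun f => ?_) f₂ f₁
    · simp only [hadd, map_add, mul_add, inner_add_left]
      rw [integral_add (hint _ _ _ _) (hint _ _ _ _)]
      ring
    · simp only [hadd, add_mul, inner_add_right]
      rw [integral_add (hint _ _ _ _) (hint _ _ _ _)]
      ring
    · simp only [hsmul, map_mul, inner_smul_left, Complex.conj_I, mul_left_comm _ (-Complex.I)]
      rw [integral_const_mul]
      ring
    · simp only [hsmul, inner_smul_right, mul_assoc Complex.I]
      rw [integral_const_mul]
      ring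
    · have : ∀ x, π.coeff g f x * (starRingEnd ℂ) (π.coeff g f x)
          = ((‖π.coeff g f x‖ ^ 2 : ℝ) : ℂ) := fun x => by
        rw [Complex.mul_conj, Complex.normSq_eq_norm_sq]
      simp only [this, hsqi, inner_self_eq_norm_sq_to_K (𝕜 := ℂ) f]
      push_cast
      exact sub_self _
  refine ⟨κ⁻¹, inv_pos.2 hκ0, fun f₁ f₂ g₁ g₂ => ?_⟩
  have hfun : (fun x => inner ℂ (π x g₁) f₁ * inner ℂ f₂ (π x g₂))
      = fun x => π.coeff g₁ f₁ x * (starRingEnd ℂ) (π.coeff g₂ f₂ x) := by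
    funext x
    simp [coeff]
  rw [hfun]
  refine ⟨hint f₁ f₂ g₁ g₂, ?_⟩
  rw [← sub_eq_zero]
  simp only [Complex.ofReal_inv, inv_inv, inner_conj_symm]
  refine sesquilin_eq_zero_of_diag (fun g₁ g₂ => ∫ x, π.coeff g₁ f₁ x
    * (starRingEnd ℂ) (π.coeff g₂ f₂ x) ∂μ - (κ : ℂ) * inner ℂ f₂ f₁ * inner ℂ g₁ g₂)
    (fun f f' h => ?_) (fun h f f' => ?_) (fun f h => ?_) (fun h f => ?_) (fun f => ?_) g₁ g₂
  · simp only [hadd', add_mul, inner_add_left]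
    rw [integral_add (hint _ _ _ _) (hint _ _ _ _)]
    ring
  · simp only [hadd', map_add, mul_add, inner_add_right]
    rw [integral_add (hint _ _ _ _) (hint _ _ _ _)]
    ring
  · simp only [hsmul', inner_smul_left, Complex.conj_I, mul_assoc (-Complex.I)]
    rw [integral_const_mul]
    ring
  · simp only [hsmul', map_mul, Complex.conj_conj, inner_smul_right, mul_left_comm _ Complex.I]
    rw [integral_const_mul]
    ring
  · simp only [hdiag, inner_self_eq_norm_sq_to_K (𝕜 := ℂ) f]
    push_cast
    exact sub_self _

theorem IsIntegrableRep.isFormalDegree_formalDegree [CompleteSpace H] [MeasurableMul G]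
    [MeasurableInv G] {π : ProjUnitaryRep G H} {μ : Measure G} [NeZero μ] [μ.IsMulLeftInvariant]
    [μ.IsInvInvariant] (hπ : π.IsIntegrableRep μ) : π.IsFormalDegree μ (π.formalDegree μ) :=
  Classical.epsilon_spec hπ.exists_isFormalDegree

end FormalDegree

end ProjUnitaryRep

/-! ### Localisation of orbits -/

theorem exists_isCompact_setLIntegral_compl_le {G : Type*} [TopologicalSpace G]
    [T2Space G] [SigmaCompactSpace G] [MeasurableSpace G] [BorelSpace G] (μ : Measure G) {F : G → ℝ≥0∞}
    (hF : ∫⁻ x, F x ∂μ ≠ ∞) {ε : ℝ≥0∞} (hε : ε ≠ 0) : ∃ C : Set G, IsCompact C ∧ ∫⁻ x in Cᶜ, F x ∂μ ≤ ε := by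
  let ν := μ.withDensity F
  have hν : ν Set.univ ≠ ∞ := by simpa [ν] using hF
  have hm : ∀ n, MeasurableSet (compactCovering G n) := fun n =>
    (isCompact_compactCovering G n).isClosed.measurableSet
  have hlim := tendsto_measure_iInter_atTop (μ := ν) (s := fun n => (compactCovering G n)ᶜ)
    (fun n => (hm n).compl.nullMeasurableSet)
    (fun m n hmn => Set.compl_subset_compl.2 (compactCovering_subset G hmn))
    ⟨0, ne_top_of_le_ne_top hν (measure_mono (Set.subset_univ _))⟩
  rw [← Set.compl_iUnion, iUnion_compactCovering, Set.compl_univ, measure_empty] at hlim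
  obtain ⟨n, hn⟩ := (hlim.eventually_le_const (pos_iff_ne_zero.2 hε)).exists
  refine ⟨_, isCompact_compactCovering G n, ?_⟩
  rwa [Function.comp_apply, withDensity_apply _ (hm n).compl] at hn

namespace ProjUnitaryRep

section Continuity

variable {G : Type*} [Group G] [TopologicalSpace G] [IsTopologicalGroup G] [T2Space G]
  [LocallyCompactSpace G] [SecondCountableTopology G] [MeasurableSpace G] [BorelSpace G]
  (μ : Measure G) [μ.IsHaarMeasure] [μ.IsMulRightInvariant]
  {H : Type*} [NormedAddCommGroup H] [InnerProductSpace ℂ H] (π : ProjUnitaryRep G H)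

include μ in
/-- A measurable projective representation is continuous up to phases. -/
theorem eventually_exists_norm_map_sub_smul_lt (g : H) {ε : ℝ} (hε : 0 < ε) :
    ∀ᶠ u in 𝓝 (1 : G), ∃ c : Circle, ‖π u g - (c : ℂ) • g‖ < ε := by
  have := isInvInvariant_of_isMulRightInvariant μ
  let := TopologicalSpace.metrizableSpaceMetric G
  obtain ⟨D, hDc, hD⟩ := (π.stronglyMeasurable g).isSeparable_range
  -- A Steinhaus argument: countably many sets `E d` cover `G`, so one has positive measure, and the
  -- quotients of its inverse fill a neighbourhood of `1`. If `u = a / b` with `a⁻¹, b⁻¹ ∈ E d`,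
  -- then `π a⁻¹ g` and `π b⁻¹ g` are both close to `d`, and `a⁻¹ * u = b⁻¹`.
  let E : H → Set G := fun d => {x | ‖π x g - d‖ < ε / 2}
  have hE : ∀ d, MeasurableSet (E d) := fun d =>
    ((π.stronglyMeasurable g).sub stronglyMeasurable_const).norm.measurable measurableSet_Iio
  have hcov : (⋃ d ∈ D, E d) = Set.univ := by
    refine Set.eq_univ_of_forall fun x => ?_
    obtain ⟨d, hd, hdist⟩ := Metric.mem_closure_iff.1 (hD ⟨x, rfl⟩) (ε / 2) (by positivity)
    simp only [Set.mem_iUnion]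
    exact ⟨d, hd, by simpa [E, dist_eq_norm] using hdist⟩
  obtain ⟨d, -, hd⟩ : ∃ d ∈ D, μ (E d) ≠ 0 := by
    by_contra! hcon
    have h0 := (measure_biUnion_null_iff hDc).2 hcon
    rw [hcov] at h0
    exact NeZero.ne μ (Measure.measure_univ_eq_zero.1 h0)
  have hpos : 0 < μ (E d)⁻¹ := by
    rw [Measure.measure_inv]
    exact pos_iff_ne_zero.2 hd
  have hnhds := Measure.div_mem_nhds_one_of_haar_pos μ _ (hE d).inv hpos
  filter_upwards [hnhds] with u hu
  obtain ⟨a, ha, b, hb, hab⟩ := Set.mem_div.1 hu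
  have ha' : ‖π a⁻¹ g - d‖ < ε / 2 := ha
  have hb' : ‖π b⁻¹ g - d‖ < ε / 2 := hb
  obtain ⟨c, hc⟩ := π.exists_map_mul a⁻¹ u
  refine ⟨c⁻¹, ?_⟩
  have hu' : a⁻¹ * u = b⁻¹ := by rw [← hab, div_eq_mul_inv, inv_mul_cancel_left]
  have h1 : π a⁻¹ (π u g) = ((c⁻¹ : Circle) : ℂ) • π b⁻¹ g := by
    rw [← hu', hc g, smul_smul, ← Circle.coe_mul, inv_mul_cancel, Circle.coe_one, one_smul]
  rw [← (π a⁻¹).norm_map, map_sub, map_smul, h1, ← smul_sub, norm_smul, Circle.norm_coe, one_mul]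
  calc ‖π b⁻¹ g - π a⁻¹ g‖ = ‖(π b⁻¹ g - d) - (π a⁻¹ g - d)‖ := by congr 1; abel
    _ ≤ ‖π b⁻¹ g - d‖ + ‖π a⁻¹ g - d‖ := norm_sub_le _ _
    _ < ε := by linarith

include μ in
theorem continuous_norm_coeff (g f : H) : Continuous fun x => ‖π.coeff g f x‖ := by
  rw [continuous_iff_continuousAt]
  intro x
  rw [ContinuousAt, Metric.tendsto_nhds]
  intro ε hε
  rw [← map_mul_left_nhds_one x, eventually_map]
  have hf : 0 < ‖f‖ + 1 := by positivity
  filter_upwards [π.eventually_exists_norm_map_sub_smul_lt μ g (div_pos hε hf)] with u hu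
  obtain ⟨c, hc⟩ := hu
  obtain ⟨e, he⟩ := π.exists_map_mul x u
  have h1 : ‖π.coeff g f (x * u)‖ = ‖inner ℂ (π x (π u g)) f‖ := by
    rw [coeff, he, inner_smul_left, norm_mul, RCLike.norm_conj, Circle.norm_coe, one_mul]
  have h2 : ‖π.coeff g f x‖ = ‖inner ℂ (π x ((c : ℂ) • g)) f‖ := by
    rw [coeff, map_smul, inner_smul_left, norm_mul, RCLike.norm_conj, Circle.norm_coe, one_mul]
  rw [Real.dist_eq, h1, h2]
  refine (abs_norm_sub_norm_le _ _).trans_lt ?_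
  rw [← inner_sub_left, ← map_sub]
  refine (norm_inner_le_norm _ _).trans_lt ?_
  rw [LinearIsometryEquiv.norm_map]
  calc ‖π u g - (c : ℂ) • g‖ * ‖f‖ ≤ ε / (‖f‖ + 1) * ‖f‖ := by gcongr
    _ < ε / (‖f‖ + 1) * (‖f‖ + 1) := by
      have := div_pos hε hf
      gcongr
      linarith
    _ = ε := div_mul_cancel₀ _ hf.ne'

/-- The modulus of the coefficient is continuous and `x` is interior to `x z Q`, so the essential
supremum over this set dominates the value at `x`. This turns the almost-everywhere condition
defining `B¹` into pointwise bounds that can be summed over `Λ`. -/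
theorem enorm_coeff_le_localMaximal {Q : Set G} (hQs : Q⁻¹ = Q) (g f : H) (x : G) {z : G}
    (hz : z ∈ interior Q) :
    ‖π.coeff g f x‖ₑ ≤ localMaximal μ Q (π.coeff g f) (x * z) := by
  by_contra! hlt
  obtain ⟨s, hs1, hs2⟩ := exists_between hlt
  have hcont : Continuous fun y => ‖π.coeff g f y‖ₑ := by
    have := (π.continuous_norm_coeff μ g f)
    simp_rw [← ofReal_norm]
    exact ENNReal.continuous_ofReal.comp this
  have hae : ∀ᵐ w ∂(μ.restrict Q), ‖π.coeff g f (x * z * w)‖ₑ < s := ae_lt_of_essSup_lt hs1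
  let O : Set G := {w | s < ‖π.coeff g f (x * z * w)‖ₑ} ∩ interior Q
  have hO : IsOpen O :=
    (isOpen_lt continuous_const (hcont.comp (continuous_const_mul (x * z)))).inter isOpen_interior
  have hz' : z⁻¹ ∈ interior Q := by
    have : (interior Q)⁻¹ = interior Q := 
      ((Homeomorph.inv G).preimage_interior Q).trans (congrArg interior hQs)
    rw [← this]
    simpa using hz
  have hne : O.Nonempty := ⟨z⁻¹, by simpa using hs2, hz'⟩
  have h0 : μ O = 0 := by
    have h1 : ∀ᵐ w ∂(μ.restrict O), ‖π.coeff g f (x * z * w)‖ₑ < s :=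
      ae_mono (Measure.restrict_mono (Set.inter_subset_right.trans interior_subset) le_rfl) hae
    rw [ae_restrict_iff' hO.measurableSet] at h1
    have h2 : ∀ᵐ w ∂μ, w ∉ O := by
      filter_upwards [h1] with w hw hwO
      exact (hw hwO).not_gt hwO.1
    simpa using measure_eq_zero_iff_ae_notMem.2 h2
  exact hO.measure_ne_zero μ hne h0

end Continuity

section Localization

variable {G : Type*} [Group G] [TopologicalSpace G] [IsTopologicalGroup G] [T2Space G]
  [LocallyCompactSpace G] [SecondCountableTopology G] [MeasurableSpace G] [BorelSpace G]
  (μ : Measure G) [μ.IsHaarMeasure] [μ.IsMulRightInvariant]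
  {H : Type*} [NormedAddCommGroup H] [InnerProductSpace ℂ H] (π : ProjUnitaryRep G H)

include μ in
/-- The index set of a Bessel family in an orbit is relatively separated. -/
theorem exists_encard_inter_smul_le {Λ : Set G} {g : H} (hg : g ≠ 0) {B : ℝ≥0∞} (hB : B ≠ ∞)
    (hbessel : ∀ f : H, ∑' l : Λ, ‖inner ℂ (π (l : G) g) f‖ₑ ^ 2 ≤ B * ‖f‖ₑ ^ 2)
    {Q : Set G} (hQc : IsCompact Q) :
    ∃ N : ℝ≥0∞, N ≠ ∞ ∧ ∀ x : G, ((Λ ∩ x • Q).encard : ℝ≥0∞) ≤ N := by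
  have hcont := π.continuous_norm_coeff μ g g
  obtain ⟨s, hs0, hs⟩ : ∃ s : ℝ, 0 < s ∧ s < ‖π.coeff g g 1‖ := by
    refine exists_between ?_
    obtain ⟨c, hc⟩ := π.exists_map_one
    rw [coeff, hc, inner_smul_left, norm_mul, RCLike.norm_conj, Circle.norm_coe, one_mul]
    simpa using pow_pos (norm_pos_iff.2 hg) 2
  -- Testing the Bessel inequality on `π x g`, each point of `Λ ∩ x • W` contributes at least `s ^
  -- 2`. Finitely many translates of `W` cover `Q`.
  let W : Set G := {w | s < ‖π.coeff g g w‖}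
  have hW : IsOpen W := isOpen_lt continuous_const hcont
  have hs2 : (ENNReal.ofReal s) ^ 2 ≠ 0 := by simpa using hs0
  have hs2t : (ENNReal.ofReal s) ^ 2 ≠ ∞ := by finiteness
  set N₀ : ℝ≥0∞ := B * ‖g‖ₑ ^ 2 / (ENNReal.ofReal s) ^ 2
  have hN₀ : N₀ ≠ ∞ := ENNReal.div_ne_top (by finiteness) hs2
  have hcount : ∀ x : G, ((Λ ∩ x • W).encard : ℝ≥0∞) ≤ N₀ := by
    intro x
    rw [ENNReal.le_div_iff_mul_le (Or.inl hs2) (Or.inl hs2t), encard_inter_eq_tsum,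
      ← ENNReal.tsum_mul_right]
    have h1 := hbessel (π x g)
    have h2 : ‖π x g‖ₑ = ‖g‖ₑ := by rw [← ofReal_norm, ← ofReal_norm]; simp
    rw [h2] at h1
    refine le_trans (ENNReal.tsum_le_tsum fun l => ?_) h1
    by_cases hl : (l : G) ∈ x • W
    · rw [Set.indicator_of_mem hl, one_mul]
      gcongr
      rw [← ofReal_norm]
      refine ENNReal.ofReal_le_ofReal ?_
      rw [norm_inner_symm, norm_inner_map_map]
      rw [Set.mem_smul_set_iff_inv_smul_mem] at hl
      rw [norm_inner_symm]
      exact le_of_lt hl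
    · simp [hl]
  obtain ⟨t, ht⟩ := hQc.elim_finite_subcover (fun y : G => y • W) (fun y => hW.smul y) (fun q _ =>
    Set.mem_iUnion.2 ⟨q, 1, hs, by simp⟩)
  refine ⟨t.card * N₀, by finiteness, fun x => ?_⟩
  calc ((Λ ∩ x • Q).encard : ℝ≥0∞)
      ≤ ∑' l : Λ, ∑ y ∈ t, ((x * y) • W).indicator (fun _ => (1 : ℝ≥0∞)) (l : G) := by
        rw [encard_inter_eq_tsum]
        refine ENNReal.tsum_le_tsum fun l => ?_
        by_cases hl : (l : G) ∈ x • Q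
        · obtain ⟨q, hq, hql⟩ := hl
          obtain ⟨y, hy, hqy⟩ := Set.mem_iUnion₂.1 (ht hq)
          have hmem : (l : G) ∈ (x * y) • W := by
            rw [mul_smul]
            exact ⟨q, hqy, hql⟩
          rw [Set.indicator_of_mem (Set.mem_smul_set.2 ⟨q, hq, hql⟩)]
          refine le_trans ?_ (Finset.single_le_sum (fun _ _ => zero_le) hy)
          rw [Set.indicator_of_mem hmem]
        · simp [hl]
    _ = ∑ y ∈ t, ((Λ ∩ (x * y) • W).encard : ℝ≥0∞) := by
        rw [Summable.tsum_finsetSum (fun _ _ => ENNReal.summable)]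
        simp_rw [encard_inter_eq_tsum]
    _ ≤ ∑ y ∈ t, N₀ := Finset.sum_le_sum fun y _ => hcount _
    _ = t.card * N₀ := by simp

variable {Q : Set G} {Λ : Set G} {N : ℝ≥0∞} {g : H}

/-- Each term is at most the mean of the maximal function over `(y⁻¹ * l) • interior Q`. These sets
overlap boundedly and avoid `C` when `l ∉ y • (C * Q)`. Taking `C` empty bounds the whole sum, and
taking `C` large bounds its tail. -/
theorem tsum_indicator_inner_mul_le (hQs : Q⁻¹ = Q) (hQ1 : Q ∈ 𝓝 (1 : G)) (hg : g ∈ π.B1 μ Q)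
    (hN : N ≠ ∞) (hΛ : ∀ x : G, ((Λ ∩ x • Q).encard : ℝ≥0∞) ≤ N) {C : Set G} (hC : IsCompact C)
    (y : G) :
    (∑' l : Λ, (y • (C * Q))ᶜ.indicator (fun z => ‖inner ℂ (π y g) (π z g)‖ₑ) (l : G))
      * μ (interior Q) ≤ N * ∫⁻ x in Cᶜ, localMaximal μ Q (π.coeff g g) x ∂μ := by
  have hCm : MeasurableSet Cᶜ := hC.isClosed.measurableSet.compl
  rw [← lintegral_indicator hCm, ← ENNReal.tsum_mul_right]
  refine le_trans (ENNReal.tsum_le_tsum fun l => ?_)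
    (tsum_lintegral_smul_le μ hQs hQ1 hN hΛ interior_subset isOpen_interior.measurableSet
      (hg.aemeasurable.indicator hCm) y)
  by_cases hl : (l : G) ∈ y • (C * Q)
  · simp [hl]
  rw [Set.indicator_of_mem (by exact hl)]
  have hnorm : ‖inner ℂ (π y g) (π (l : G) g)‖ₑ = ‖π.coeff g g (y⁻¹ * l)‖ₑ := by
    rw [← ofReal_norm, ← ofReal_norm, norm_inner_map_map, coeff, norm_inner_symm]
  rw [hnorm]
  set w := y⁻¹ * (l : G)
  have hm : MeasurableSet (w • interior Q) := isOpen_interior.measurableSet.const_smul w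
  calc ‖π.coeff g g w‖ₑ * μ (interior Q)
      = ∫⁻ v in w • interior Q, ‖π.coeff g g w‖ₑ ∂μ := by
        rw [lintegral_const, Measure.restrict_apply_univ, measure_smul]
    _ ≤ _ := by
        refine setLIntegral_mono' hm fun v hv => ?_
        obtain ⟨z, hz, rfl⟩ := hv
        have hvC : w • z ∈ Cᶜ := by
          intro hvC
          refine hl ?_
          rw [Set.mem_smul_set_iff_inv_smul_mem]
          refine ⟨w • z, hvC, z⁻¹, ?_, by simp [w]⟩
          rw [← hQs]
          simpa using interior_subset hz
        change _ ≤ Cᶜ.indicator _ (w • z)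
        rw [Set.indicator_of_mem hvC]
        exact π.enorm_coeff_le_localMaximal μ hQs g g w hz

/-- Uniform summability of the cross-Gram kernel of `g ∈ B¹` along a relatively separated set. -/
theorem exists_tsum_inner_le (hQc : IsCompact Q) (hQs : Q⁻¹ = Q) (hQ1 : Q ∈ 𝓝 (1 : G))
    (hg : g ∈ π.B1 μ Q) (hN : N ≠ ∞) (hΛ : ∀ x : G, ((Λ ∩ x • Q).encard : ℝ≥0∞) ≤ N) :
    ∃ M : ℝ≥0∞, M ≠ ∞ ∧ ∀ y : G, ∑' l : Λ, ‖inner ℂ (π y g) (π (l : G) g)‖ₑ ≤ M := by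
  have h0 : μ (interior Q) ≠ 0 :=
    isOpen_interior.measure_ne_zero μ ⟨1, mem_interior_iff_mem_nhds.2 hQ1⟩
  have ht : μ (interior Q) ≠ ∞ := ne_top_of_le_ne_top hQc.measure_lt_top.ne
    (measure_mono interior_subset)
  refine ⟨N * (∫⁻ x, localMaximal μ Q (π.coeff g g) x ∂μ) / μ (interior Q),
    ENNReal.div_ne_top (ENNReal.mul_ne_top hN hg.lintegral_lt_top.ne) h0, fun y => ?_⟩
  rw [ENNReal.le_div_iff_mul_le (Or.inl h0) (Or.inl ht)]
  have h1 := π.tsum_indicator_inner_mul_le μ hQs hQ1 hg hN hΛ isCompact_empty y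
  simpa only [Set.empty_mul, Set.smul_set_empty, Set.compl_empty, Set.indicator_univ,
    Measure.restrict_univ] using h1

/-- Uniform decay of the cross-Gram kernel of `g ∈ B¹` along a relatively separated set. -/
theorem exists_isCompact_tsum_indicator_inner_le (hQc : IsCompact Q) (hQs : Q⁻¹ = Q)
    (hQ1 : Q ∈ 𝓝 (1 : G)) (hg : g ∈ π.B1 μ Q) (hN : N ≠ ∞)
    (hΛ : ∀ x : G, ((Λ ∩ x • Q).encard : ℝ≥0∞) ≤ N) {ε : ℝ≥0∞} (hε : ε ≠ 0) :
    ∃ C : Set G, IsCompact C ∧ ∀ y : G,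
      ∑' l : Λ, (y • C)ᶜ.indicator (fun z => ‖inner ℂ (π y g) (π z g)‖ₑ) (l : G) ≤ ε := by
  have h0 : μ (interior Q) ≠ 0 :=
    isOpen_interior.measure_ne_zero μ ⟨1, mem_interior_iff_mem_nhds.2 hQ1⟩
  have ht : μ (interior Q) ≠ ∞ := ne_top_of_le_ne_top hQc.measure_lt_top.ne
    (measure_mono interior_subset)
  obtain ⟨C, hC, hCε⟩ := exists_isCompact_setLIntegral_compl_le μ hg.lintegral_lt_top.ne
    (ε := ε * μ (interior Q) / (N + 1)) (by simp [hε, h0, hN])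
  refine ⟨C * Q, hC.mul hQc, fun y => ?_⟩
  refine (ENNReal.mul_le_mul_iff_left h0 ht).1
    ((π.tsum_indicator_inner_mul_le μ hQs hQ1 hg hN hΛ hC y).trans ?_)
  calc N * ∫⁻ x in Cᶜ, localMaximal μ Q (π.coeff g g) x ∂μ
      ≤ (N + 1) * (ε * μ (interior Q) / (N + 1)) := by
        gcongr
        exact le_self_add
    _ = ε * μ (interior Q) := ENNReal.mul_div_cancel (by simp) (by finiteness)

end Localization

end ProjUnitaryRep

/-! ### Frame operators and the removal of frame elements -/

section Schur

theorem ENNReal.two_mul_mul_le_sq_add_sq (a b : ℝ≥0∞) : 2 * (a * b) ≤ a ^ 2 + b ^ 2 := by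
  rcases le_total a b with h | h <;> obtain ⟨t, rfl⟩ := exists_add_of_le h
  · calc 2 * (a * (a + t)) ≤ 2 * (a * (a + t)) + t ^ 2 := le_self_add
      _ = _ := by ring
  · calc 2 * ((b + t) * b) ≤ 2 * ((b + t) * b) + t ^ 2 := le_self_add
      _ = _ := by ring

/-- Weighted Cauchy–Schwarz, obtained by summing `2 c i c j ≤ c i ^ 2 + c j ^ 2` against `k i * k
j`; no finiteness is needed. -/
theorem ENNReal.tsum_mul_sq_le {ι : Type*} (k c : ι → ℝ≥0∞) :
    (∑' i, k i * c i) ^ 2 ≤ (∑' i, k i) * ∑' i, k i * c i ^ 2 := by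
  have h2 : 2 * (∑' i, k i * c i) ^ 2 ≤ 2 * ((∑' i, k i) * ∑' i, k i * c i ^ 2) := by
    have h1 : ∑' i, ∑' j, k i * k j * (c i ^ 2 + c j ^ 2)
        = 2 * ((∑' i, k i) * ∑' i, k i * c i ^ 2) := by
      simp_rw [mul_add, ENNReal.tsum_add]
      rw [two_mul]
      congr 1
      · simp_rw [mul_right_comm _ _ (c _ ^ 2), ENNReal.tsum_mul_left, ENNReal.tsum_mul_right]
        rw [mul_comm]
      · simp_rw [mul_assoc, ENNReal.tsum_mul_left, ENNReal.tsum_mul_right]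
    rw [← h1, pow_two, ← ENNReal.tsum_mul_right, ← ENNReal.tsum_mul_left]
    refine ENNReal.tsum_le_tsum fun i => ?_
    rw [← ENNReal.tsum_mul_left, ← ENNReal.tsum_mul_left]
    refine ENNReal.tsum_le_tsum fun j => ?_
    calc 2 * (k i * c i * (k j * c j)) = k i * k j * (2 * (c i * c j)) := by ring
      _ ≤ _ := by gcongr; exact ENNReal.two_mul_mul_le_sq_add_sq _ _
  exact (ENNReal.mul_le_mul_iff_right two_ne_zero ENNReal.ofNat_ne_top).1 h2

/-- The Schur test. -/
theorem ENNReal.tsum_tsum_mul_sq_le {ι κ : Type*} (k : ι → κ → ℝ≥0∞) (c : κ → ℝ≥0∞)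
    {r s : ℝ≥0∞} (hr : ∀ i, ∑' j, k i j ≤ r) (hs : ∀ j, ∑' i, k i j ≤ s) :
    ∑' i, (∑' j, k i j * c j) ^ 2 ≤ r * s * ∑' j, c j ^ 2 := by
  calc ∑' i, (∑' j, k i j * c j) ^ 2 ≤ ∑' i, r * ∑' j, k i j * c j ^ 2 := by
        refine ENNReal.tsum_le_tsum fun i => (ENNReal.tsum_mul_sq_le _ _).trans ?_
        gcongr
        exact hr i
    _ = r * ∑' j, (∑' i, k i j) * c j ^ 2 := by
        rw [ENNReal.tsum_mul_left, ENNReal.tsum_comm]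
        simp_rw [ENNReal.tsum_mul_right]
    _ ≤ r * ∑' j, s * c j ^ 2 := by gcongr with j; exact hs j
    _ = _ := by rw [ENNReal.tsum_mul_left, mul_assoc]

end Schur

section Frame

variable {ι : Type*} {H : Type*} [NormedAddCommGroup H] [InnerProductSpace ℂ H]

/-- `S` is the frame operator of `v`, with frame bounds `A` and `B`. -/
structure IsFrameOperator (v : ι → H) (S : H →L[ℂ] H) (A B : ℝ) : Prop where
  pos : 0 < A
  hasSum : ∀ f h : H, HasSum (fun i => inner ℂ f (v i) * inner ℂ (v i) h) (inner ℂ f (S h))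
  hasSum_sq : ∀ f : H, HasSum (fun i => ‖inner ℂ (v i) f‖ ^ 2) (inner ℂ f (S f)).re
  lower : ∀ f : H, A * ‖f‖ ^ 2 ≤ (inner ℂ f (S f)).re
  upper : ∀ f : H, (inner ℂ f (S f)).re ≤ B * ‖f‖ ^ 2

theorem IsHilbertFrame.exists_isFrameOperator [CompleteSpace H] {v : ι → H}
    (hv : IsHilbertFrame v) : ∃ (S : H →L[ℂ] H) (A B : ℝ), 0 < B ∧ IsFrameOperator v S A B := by
  obtain ⟨A, B, hA, hB, hAB⟩ := hv
  let T : H →ₗ[ℂ] lp (fun _ : ι => ℂ) 2 :=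
    { toFun := fun f => ⟨fun i => inner ℂ (v i) f, memℓp_gen (by simpa using (hAB f).1)⟩
      map_add' := fun f h => by ext i; exact inner_add_right _ _ _
      map_smul' := fun c f => by ext i; exact inner_smul_right _ _ _ }
  have hT : ∀ f i, T f i = inner ℂ (v i) f := fun f i => rfl
  have hnorm : ∀ f, ‖T f‖ ^ 2 = ∑' i, ‖inner ℂ (v i) f‖ ^ 2 := fun f => by
    have h1 := lp.norm_rpow_eq_tsum (p := 2) (by norm_num) (T f)
    simpa [hT] using h1
  let T' : H →L[ℂ] lp (fun _ : ι => ℂ) 2 := T.mkContinuous (Real.sqrt B) fun f => by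
    refine le_of_sq_le_sq ?_ (by positivity)
    rw [hnorm, mul_pow, Real.sq_sqrt hB.le]
    exact (hAB f).2.2
  let S := T'.adjoint.comp T'
  have hS : ∀ f h, inner ℂ f (S h) = inner ℂ (T f) (T h) := fun f h => by
    change inner ℂ f (T'.adjoint (T' h)) = _
    rw [ContinuousLinearMap.adjoint_inner_right]
    rfl
  have hSre : ∀ f, (inner ℂ f (S f)).re = ∑' i, ‖inner ℂ (v i) f‖ ^ 2 := fun f => by
    rw [hS, ← hnorm]
    exact inner_self_eq_norm_sq (𝕜 := ℂ) (T f)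
  refine ⟨S, A, B, hB, hA, fun f h => ?_, fun f => ?_, fun f => ?_, fun f => ?_⟩
  · rw [hS]
    have h1 := lp.hasSum_inner (𝕜 := ℂ) (T f) (T h)
    have h2 : (fun i => inner ℂ (T f i) (T h i))
        = fun i => inner ℂ f (v i) * inner ℂ (v i) h := by
      funext i
      rw [hT, hT, RCLike.inner_apply, inner_conj_symm, mul_comm]
    rw [h2] at h1
    exact h1
  · rw [hSre]
    exact (hAB f).1.hasSum
  · rw [hSre]
    exact (hAB f).2.1
  · rw [hSre]
    exact (hAB f).2.2

namespace IsFrameOperator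

variable {v : ι → H} {S : H →L[ℂ] H} {A B : ℝ}

theorem inner_symm (hS : IsFrameOperator v S A B) (f h : H) :
    inner ℂ (S f) h = inner ℂ f (S h) := by
  have h1 := (hS.hasSum h f).star
  refine HasSum.unique ?_ (hS.hasSum f h)
  convert h1 using 1
  · funext i
    simp [mul_comm]
  · simp

theorem isSelfAdjoint [CompleteSpace H] (hS : IsFrameOperator v S A B) : IsSelfAdjoint S := by
  rw [ContinuousLinearMap.isSelfAdjoint_iff_isSymmetric]
  exact hS.inner_symm

/-- The frame bounds say `A ≤ S ≤ B`, hence `0 ≤ 1 - S / B ≤ 1 - A / B` as operators, and for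
positive operators this order bounds the norm. -/
theorem norm_one_sub_smul_le [CompleteSpace H] (hS : IsFrameOperator v S A B) (hB : 0 < B)
    (hAB : A ≤ B) : ‖1 - ((B⁻¹ : ℝ) : ℂ) • S‖ ≤ 1 - A / B := by
  have hSA := hS.isSelfAdjoint
  have hX : IsSelfAdjoint (1 - ((B⁻¹ : ℝ) : ℂ) • S) := by
    refine (IsSelfAdjoint.one _).sub (IsSelfAdjoint.smul ?_ hSA)
    exact Complex.conj_ofReal _
  have hq : 0 ≤ 1 - A / B := by
    rw [sub_nonneg, div_le_one hB]
    exact hAB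
  have hform : ∀ f, (inner ℂ ((1 - ((B⁻¹ : ℝ) : ℂ) • S) f) f).re
      = ‖f‖ ^ 2 - B⁻¹ * (inner ℂ f (S f)).re := fun f => by
    have h1 : (inner ℂ f f : ℂ).re = ‖f‖ ^ 2 := inner_self_eq_norm_sq (𝕜 := ℂ) f
    simp only [sub_apply, one_apply_eq_self,
      smul_apply, inner_sub_left, inner_smul_left, Complex.conj_ofReal,
      Complex.sub_re, Complex.re_ofReal_mul, h1, hS.inner_symm]
  have h0 : 0 ≤ 1 - ((B⁻¹ : ℝ) : ℂ) • S := by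
    rw [ContinuousLinearMap.nonneg_iff_isPositive, ContinuousLinearMap.isPositive_def']
    refine ⟨hX, fun f => ?_⟩
    change 0 ≤ (inner ℂ _ _ : ℂ).re
    rw [hform, sub_nonneg, inv_mul_le_iff₀ hB]
    exact hS.upper f
  rw [CStarAlgebra.norm_le_iff_le_algebraMap _ hq h0]
  rw [ContinuousLinearMap.le_def, ContinuousLinearMap.isPositive_def']
  refine ⟨(IsSelfAdjoint.algebraMap _ (IsSelfAdjoint.all _)).sub hX, fun f => ?_⟩
  change 0 ≤ (inner ℂ _ _ : ℂ).re
  have h1 : (inner ℂ f f : ℂ).re = ‖f‖ ^ 2 := inner_self_eq_norm_sq (𝕜 := ℂ) f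
  rw [sub_apply, inner_sub_left, Complex.sub_re, hform,
    Algebra.algebraMap_eq_smul_one]
  have h2 : (inner ℂ (((1 - A / B : ℝ) • (1 : H →L[ℂ] H)) f) f).re = (1 - A / B) * ‖f‖ ^ 2 := by
    rw [smul_apply, one_apply_eq_self, RCLike.real_smul_eq_coe_smul (K := ℂ),
      inner_smul_left, RCLike.conj_ofReal, ← h1]
    exact Complex.re_ofReal_mul _ _
  rw [h2]
  have h3 := hS.lower f
  have h4 : A / B * ‖f‖ ^ 2 ≤ B⁻¹ * (inner ℂ f (S f)).re := by
    rw [div_eq_inv_mul, mul_assoc]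
    gcongr
  nlinarith

/-- Approximate inverses of a frame operator, obtained from the Neumann series. They lie in every
class of operators that contains the identity and is closed under linear combinations and under
composition with `S`. -/
theorem exists_approx_inverse [CompleteSpace H] (hS : IsFrameOperator v S A B) (hB : 0 < B)
    (hAB : A ≤ B) (P : (H →L[ℂ] H) → Prop) (h1 : P 1) (hadd : ∀ X Y, P X → P Y → P (X + Y))
    (hsmul : ∀ (c : ℂ) X, P X → P (c • X)) (hmul : ∀ X, P X → P (X * S)) {δ : ℝ} (hδ : 0 < δ) :
    ∃ R : H →L[ℂ] H, IsSelfAdjoint R ∧ P R ∧ ‖1 - R * S‖ ≤ δ := by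
  set X : H →L[ℂ] H := 1 - ((B⁻¹ : ℝ) : ℂ) • S with hXdef
  have hX : IsSelfAdjoint X := by
    refine (IsSelfAdjoint.one _).sub (IsSelfAdjoint.smul ?_ hS.isSelfAdjoint)
    exact Complex.conj_ofReal _
  have hPX : ∀ k : ℕ, P (X ^ k) := by
    intro k
    induction k with
    | zero => simpa using h1
    | succ k ih =>
      have : X ^ (k + 1) = X ^ k + (-((B⁻¹ : ℝ) : ℂ)) • (X ^ k * S) := by
        rw [pow_succ]
        conv_lhs => rw [hXdef]
        rw [← hXdef, mul_sub, mul_one, mul_smul_comm, neg_smul, sub_eq_add_neg]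
      rw [this]
      exact hadd _ _ ih (hsmul _ _ (hmul _ ih))
  have hnorm : ‖X‖ < 1 := (hS.norm_one_sub_smul_le hB hAB).trans_lt
    (by have := div_pos hS.pos hB; linarith)
  obtain ⟨m, hm⟩ := exists_pow_lt_of_lt_one hδ hnorm
  -- Since `S / B = 1 - X`, the geometric sum telescopes to `1 - R * S = X ^ (m + 1)`.
  refine ⟨((B⁻¹ : ℝ) : ℂ) • ∑ k ∈ Finset.range (m + 1), X ^ k, ?_, ?_, ?_⟩
  · refine IsSelfAdjoint.smul (Complex.conj_ofReal _) ?_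
    exact isSelfAdjoint_sum _ fun k _ => hX.pow k
  · refine hsmul _ _ ?_
    induction m + 1 with
    | zero => simpa using hsmul 0 1 h1
    | succ k ih =>
      rw [Finset.sum_range_succ]
      exact hadd _ _ ih (hPX k)
  · have h2 : ((B⁻¹ : ℝ) : ℂ) • S = 1 - X := by rw [hXdef]; abel
    rw [smul_mul_assoc, ← mul_smul_comm, h2, geom_sum_mul_neg, sub_sub_cancel]
    refine (norm_pow_le' X (Nat.succ_pos m)).trans ?_
    rw [pow_succ]
    nlinarith [norm_nonneg X, pow_nonneg (norm_nonneg X) m]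

end IsFrameOperator

end Frame

theorem ENNReal.add_add_sq_le (p q r : ℝ≥0∞) :
    (p + q + r) ^ 2 ≤ 3 * (p ^ 2 + q ^ 2 + r ^ 2) := by
  calc (p + q + r) ^ 2
      = p ^ 2 + q ^ 2 + r ^ 2 + (2 * (p * q) + 2 * (p * r) + 2 * (q * r)) := by ring
    _ ≤ p ^ 2 + q ^ 2 + r ^ 2 + ((p ^ 2 + q ^ 2) + (p ^ 2 + r ^ 2) + (q ^ 2 + r ^ 2)) := by
        gcongr <;> exact ENNReal.two_mul_mul_le_sq_add_sq _ _
    _ = _ := by ring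

namespace IsFrameOperator

variable {ι : Type*} {H : Type*} [NormedAddCommGroup H] [InnerProductSpace ℂ H]
  {v : ι → H} {S : H →L[ℂ] H} {A B : ℝ}

theorem tsum_enorm_sq (hS : IsFrameOperator v S A B) (f : H) :
    ∑' i, ‖inner ℂ (v i) f‖ₑ ^ 2 = ENNReal.ofReal (inner ℂ f (S f)).re := by
  rw [← (hS.hasSum_sq f).tsum_eq, ENNReal.ofReal_tsum_of_nonneg (fun i => by positivity)
    (hS.hasSum_sq f).summable]
  congr 1 with i
  rw [ENNReal.ofReal_pow (norm_nonneg _), ofReal_norm]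

theorem tsum_enorm_sq_le (hS : IsFrameOperator v S A B) (f : H) :
    ∑' i, ‖inner ℂ (v i) f‖ₑ ^ 2 ≤ ENNReal.ofReal B * ‖f‖ₑ ^ 2 := by
  rw [hS.tsum_enorm_sq, ← ofReal_norm, ← ENNReal.ofReal_pow (norm_nonneg _),
    ← ENNReal.ofReal_mul' (by positivity)]
  exact ENNReal.ofReal_le_ofReal (hS.upper f)

theorem le_tsum_enorm_sq (hS : IsFrameOperator v S A B) (f : H) :
    ENNReal.ofReal A * ‖f‖ₑ ^ 2 ≤ ∑' i, ‖inner ℂ (v i) f‖ₑ ^ 2 := by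
  rw [hS.tsum_enorm_sq, ← ofReal_norm, ← ENNReal.ofReal_pow (norm_nonneg _),
    ← ENNReal.ofReal_mul' (by positivity)]
  exact ENNReal.ofReal_le_ofReal (hS.lower f)

/-- The pointwise estimate behind the removal theorem. -/
theorem mul_enorm_inner_le [CompleteSpace H] (hS : IsFrameOperator v S A B) {R : H →L[ℂ] H}
    (hR : IsSelfAdjoint R) {α : ℝ} {J : Set ι} {i : ι}
    (hi : (inner ℂ (v i) (R (v i))).re ≤ α) (f : H) :
    ENNReal.ofReal (1 - α) * ‖inner ℂ (v i) f‖ₑ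
      ≤ ∑' j, (J \ {i}).indicator (fun j => ‖inner ℂ (v i) (R (v j))‖ₑ) j * ‖inner ℂ (v j) f‖ₑ
        + ∑' j, Jᶜ.indicator (fun j => ‖inner ℂ (v i) (R (v j))‖ₑ) j * ‖inner ℂ (v j) f‖ₑ
        + ‖inner ℂ (v i) ((1 - R * S) f)‖ₑ := by
  classical
  have hRsymm : ∀ a b : H, inner ℂ (R a) b = inner ℂ a (R b) :=
    (ContinuousLinearMap.isSelfAdjoint_iff_isSymmetric.1 hR)
  set w : ι → ℂ := fun j => inner ℂ (v i) (R (v j)) * inner ℂ (v j) f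
  have hsum : HasSum w (inner ℂ (v i) (R (S f))) := by
    have := hS.hasSum (R (v i)) f
    simpa only [hRsymm] using this
  have hsplit : HasSum (fun j => if j = i then 0 else w j) (inner ℂ (v i) (R (S f)) - w i) := by
    have h1 := hsum.sub (hasSum_ite_eq i (w i))
    have h2 : (fun j => w j - if j = i then w i else 0) = fun j => if j = i then 0 else w j := by
      funext j
      by_cases hj : j = i <;> simp [hj]
    rwa [h2] at h1
  -- Write `f = R S f + (1 - R S) f`, expand `R S f` in the frame, and move the term `j = i` to the
  -- left.
  have hdec : (1 - inner ℂ (v i) (R (v i))) * inner ℂ (v i) f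
      = (∑' j, if j = i then 0 else w j) + inner ℂ (v i) ((1 - R * S) f) := by
    rw [hsplit.tsum_eq]
    simp only [w, sub_apply, one_apply_eq_self, inner_sub_right, ContinuousLinearMap.mul_def,
      ContinuousLinearMap.comp_apply]
    ring
  calc ENNReal.ofReal (1 - α) * ‖inner ℂ (v i) f‖ₑ
      ≤ ‖(1 - inner ℂ (v i) (R (v i))) * inner ℂ (v i) f‖ₑ := by
        rw [enorm_mul]
        gcongr
        rw [← ofReal_norm]
        refine ENNReal.ofReal_le_ofReal ?_
        refine le_trans ?_ (Complex.re_le_norm _)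
        simp only [Complex.sub_re, Complex.one_re]
        linarith
    _ ≤ ‖∑' j, if j = i then 0 else w j‖ₑ + ‖inner ℂ (v i) ((1 - R * S) f)‖ₑ := by
        rw [hdec]
        exact enorm_add_le _ _
    _ ≤ _ := by
        gcongr
        refine (enorm_tsum_le_tsum_enorm).trans ?_
        rw [← ENNReal.tsum_add]
        refine ENNReal.tsum_le_tsum fun j => ?_
        by_cases hj : j = i
        · simp [hj]
        · by_cases hJ : j ∈ J <;> simp [hj, hJ, w, enorm_mul]

/-- Removal of frame elements: if the diagonal of the approximate Gram matrix is at most `α < 1` on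
`J` and the off-diagonal part of its `J`-block is small, then the elements in `J` can be removed. -/
theorem exists_lower_bound_compl [CompleteSpace H] (hS : IsFrameOperator v S A B) (hB : 0 < B)
    {R : H →L[ℂ] H}
    (hR : IsSelfAdjoint R) {α ε δ : ℝ} (hα : α < 1) (hε : 0 ≤ ε) {J : Set ι}
    (hdiag : ∀ i ∈ J, (inner ℂ (v i) (R (v i))).re ≤ α)
    (hoff : ∀ i ∈ J, ∑' j, (J \ {i}).indicator (fun j => ‖inner ℂ (v i) (R (v j))‖ₑ) j
      ≤ ENNReal.ofReal ε)
    {M : ℝ≥0∞} (hM : M ≠ ∞) (hrow : ∀ i, ∑' j, ‖inner ℂ (v i) (R (v j))‖ₑ ≤ M)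
    (hδ : ‖1 - R * S‖ ≤ δ) (hsmall : 3 * (ε ^ 2 + B / A * δ ^ 2) ≤ (1 - α) ^ 2 / 2) :
    ∃ A' : ℝ, 0 < A' ∧ ∀ f : H,
      ENNReal.ofReal A' * ‖f‖ₑ ^ 2 ≤ ∑' j : (Jᶜ : Set ι), ‖inner ℂ (v j) f‖ₑ ^ 2 := by
  classical
  have hA := hS.pos
  have hδ0 : 0 ≤ δ := (norm_nonneg _).trans hδ
  have hRsymm : ∀ a b : H, ‖inner ℂ a (R b)‖ₑ = ‖inner ℂ b (R a)‖ₑ := fun a b => by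
    have h1 : inner ℂ (R a) b = inner ℂ a (R b) :=
      ContinuousLinearMap.isSelfAdjoint_iff_isSymmetric.1 hR a b
    rw [← ofReal_norm, ← ofReal_norm, ← h1, norm_inner_symm]
  lift M to NNReal using hM
  set a : ℝ := (1 - α) ^ 2
  have ha : 0 < a := pow_pos (by linarith) 2
  set L : ℝ := 3 * ((M : ℝ) ^ 2 + B / A * δ ^ 2)
  have hL : 0 ≤ L := by positivity
  refine ⟨A / (1 + 2 * L / a), by positivity, fun f => ?_⟩
  let c : ι → ℝ≥0∞ := fun i => ‖inner ℂ (v i) f‖ₑ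
  -- `X` and `Y` are the coefficient energies of `f` on `J` and off `J`. The aim is `X ≤ (2 L / a)
  -- Y`, which with `A ‖f‖² ≤ X + Y` gives the claimed bound.
  set X : ℝ≥0∞ := ∑' j, J.indicator c j ^ 2
  set Y : ℝ≥0∞ := ∑' j, Jᶜ.indicator c j ^ 2
  have hY : ∑' j : (Jᶜ : Set ι), ‖inner ℂ (v j) f‖ₑ ^ 2 = Y := by
    rw [tsum_subtype Jᶜ (fun j => c j ^ 2)]
    congr 1 with j
    by_cases hj : j ∈ J <;> simp [hj]
  have hXY : X + Y = ∑' j, c j ^ 2 := by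
    rw [← ENNReal.tsum_add]
    congr 1 with j
    by_cases hj : j ∈ J <;> simp [hj]
  have hfin : ∑' j, c j ^ 2 ≠ ∞ := by
    rw [hS.tsum_enorm_sq f]
    exact ENNReal.ofReal_ne_top
  have hXt : X ≠ ∞ := ne_top_of_le_ne_top hfin (hXY ▸ le_self_add)
  have hYt : Y ≠ ∞ := ne_top_of_le_ne_top hfin (hXY ▸ le_add_self)
  let k : ι → ι → ℝ≥0∞ := fun i j => ‖inner ℂ (v i) (R (v j))‖ₑ
  let k₁ : ι → ι → ℝ≥0∞ := fun i j => if i ∈ J ∧ j ∈ J ∧ j ≠ i then k i j else 0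
  let k₂ : ι → ι → ℝ≥0∞ := fun i j => if i ∈ J ∧ j ∉ J then k i j else 0
  let e : ι → ℝ≥0∞ := fun i => ‖inner ℂ (v i) ((1 - R * S) f)‖ₑ
  have hpt : ∀ i, ENNReal.ofReal (1 - α) * J.indicator c i
      ≤ ∑' j, k₁ i j * J.indicator c j + ∑' j, k₂ i j * Jᶜ.indicator c j + e i := by
    intro i
    by_cases hi : i ∈ J
    · rw [Set.indicator_of_mem hi]
      refine (hS.mul_enorm_inner_le hR (J := J) (hdiag i hi) f).trans (le_of_eq ?_)
      congr 3
      · funext j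
        by_cases hj : j ∈ J <;> by_cases hji : j = i <;> simp [k₁, k, c, hi, hj, hji]
      · funext j
        by_cases hj : j ∈ J <;> simp [k₂, k, c, hi, hj]
    · simp [hi]
  have hrow₁ : ∀ i, ∑' j, k₁ i j ≤ ENNReal.ofReal ε := by
    intro i
    by_cases hi : i ∈ J
    · refine le_trans (le_of_eq ?_) (hoff i hi)
      congr 1 with j
      by_cases hj : j ∈ J <;> by_cases hji : j = i <;> simp [k₁, k, hi, hj, hji]
    · simp [k₁, hi]
  -- Self-adjointness of `R` lets the row bounds serve as column bounds in the Schur test.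
  have hsymm₁ : ∀ i j, k₁ i j = k₁ j i := by
    intro i j
    rcases eq_or_ne i j with rfl | h
    · rfl
    · by_cases hi : i ∈ J <;> by_cases hj : j ∈ J <;>
        simp [k₁, k, hi, hj, h, h.symm, hRsymm (v i) (v j)]
  have h₂le : ∀ i j, k₂ i j ≤ k i j := by
    intro i j
    simp only [k₂]
    split_ifs
    · exact le_rfl
    · exact zero_le
  have hS₁ := ENNReal.tsum_tsum_mul_sq_le k₁ (J.indicator c) hrow₁
    (fun j => by simpa only [hsymm₁ _ j] using hrow₁ j)
  have hS₂ := ENNReal.tsum_tsum_mul_sq_le k₂ (Jᶜ.indicator c)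
    (fun i => (ENNReal.tsum_le_tsum (h₂le i)).trans (hrow i))
    (fun j => (ENNReal.tsum_le_tsum fun i => (h₂le i j).trans (hRsymm (v i) (v j)).le).trans
      (hrow j))
  -- The upper frame bound passes from coefficients to `‖(1 - R * S) f‖`, and the lower one back
  -- from `‖f‖` to `X + Y`; hence the factor `B / A`.
  have hE : ∑' i, e i ^ 2 ≤ ENNReal.ofReal (B / A * δ ^ 2) * (X + Y) := by
    calc ∑' i, e i ^ 2 ≤ ENNReal.ofReal B * ‖(1 - R * S) f‖ₑ ^ 2 := hS.tsum_enorm_sq_le _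
      _ ≤ ENNReal.ofReal B * (ENNReal.ofReal δ * ‖f‖ₑ) ^ 2 := by
        gcongr
        rw [← ofReal_norm, ← ofReal_norm, ← ENNReal.ofReal_mul hδ0]
        exact ENNReal.ofReal_le_ofReal ((ContinuousLinearMap.le_opNorm _ _).trans (by gcongr))
      _ = ENNReal.ofReal (B / A * δ ^ 2) * (ENNReal.ofReal A * ‖f‖ₑ ^ 2) := by
        rw [mul_pow, ← mul_assoc, ← mul_assoc, ← ENNReal.ofReal_pow hδ0,
          ← ENNReal.ofReal_mul hB.le, ← ENNReal.ofReal_mul (by positivity)]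
        congr 2
        field_simp
      _ ≤ _ := by
        gcongr
        rw [hXY]
        exact hS.le_tsum_enorm_sq f
  have hmain : ENNReal.ofReal a * X ≤ 3 * (ENNReal.ofReal (ε ^ 2) * X
      + ENNReal.ofReal ((M : ℝ) ^ 2) * Y + ENNReal.ofReal (B / A * δ ^ 2) * (X + Y)) := by
    calc ENNReal.ofReal a * X = ∑' i, (ENNReal.ofReal (1 - α) * J.indicator c i) ^ 2 := by
          simp_rw [mul_pow]
          rw [ENNReal.tsum_mul_left, ← ENNReal.ofReal_pow (by linarith)]
      _ ≤ ∑' i, 3 * ((∑' j, k₁ i j * J.indicator c j) ^ 2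
          + (∑' j, k₂ i j * Jᶜ.indicator c j) ^ 2 + e i ^ 2) := by
          refine ENNReal.tsum_le_tsum fun i => ?_
          refine (pow_le_pow_left' (hpt i) 2).trans (ENNReal.add_add_sq_le _ _ _)
      _ ≤ _ := by
          rw [ENNReal.tsum_mul_left, ENNReal.tsum_add, ENNReal.tsum_add]
          gcongr
          · refine hS₁.trans (le_of_eq ?_)
            rw [ENNReal.ofReal_pow hε, pow_two]
          · refine hS₂.trans (le_of_eq ?_)
            rw [ENNReal.ofReal_pow (by positivity), ENNReal.ofReal_coe_nnreal, pow_two]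
  rw [hY]
  have hlow := hS.le_tsum_enorm_sq f
  rw [show ∑' i, ‖inner ℂ (v i) f‖ₑ ^ 2 = X + Y from hXY.symm] at hlow
  rw [← ENNReal.ofReal_toReal hXt, ← ENNReal.ofReal_toReal hYt] at hmain hlow
  rw [← ENNReal.ofReal_toReal hYt]
  set x := X.toReal
  set y := Y.toReal
  have hx : 0 ≤ x := ENNReal.toReal_nonneg
  have hy : 0 ≤ y := ENNReal.toReal_nonneg
  have hBA : 0 ≤ B / A * δ ^ 2 := by positivity
  have h3 : (3 : ℝ≥0∞) = ENNReal.ofReal 3 := by norm_num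
  rw [← ENNReal.ofReal_add hx hy, h3, ← ENNReal.ofReal_mul ha.le,
    ← ENNReal.ofReal_mul (sq_nonneg _), ← ENNReal.ofReal_mul (sq_nonneg _),
    ← ENNReal.ofReal_mul hBA, ← ENNReal.ofReal_add (by positivity) (by positivity),
    ← ENNReal.ofReal_add (by positivity) (by positivity), ← ENNReal.ofReal_mul (by norm_num),
    ENNReal.ofReal_le_ofReal_iff (by positivity)] at hmain
  rw [← ofReal_norm, ← ENNReal.ofReal_pow (norm_nonneg _), ← ENNReal.ofReal_mul hA.le,
    ← ENNReal.ofReal_add hx hy, ENNReal.ofReal_le_ofReal_iff (by positivity)] at hlow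
  rw [← ofReal_norm, ← ENNReal.ofReal_pow (norm_nonneg _), ← ENNReal.ofReal_mul (by positivity)]
  refine ENNReal.ofReal_le_ofReal ?_
  -- By `hsmall`, the part of the right side proportional to `x` is at most half of the left side
  -- and can be absorbed.
  have h4 : a * x ≤ a / 2 * x + L * y := by
    have h5 : 3 * (ε ^ 2 + B / A * δ ^ 2) * x ≤ a / 2 * x := by gcongr
    simp only [L]
    linarith
  have h6 : x ≤ 2 * L / a * y := by
    rw [div_mul_eq_mul_div, le_div_iff₀ ha]
    linarith
  rw [div_mul_eq_mul_div, div_le_iff₀ (by positivity)]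
  linarith

end IsFrameOperator

/-! ### Operators localised along the orbit -/

namespace ProjUnitaryRep

section LocalizedOperators

variable {G : Type*} [Group G] [TopologicalSpace G] [MeasurableSpace G]
  {H : Type*} [NormedAddCommGroup H] [InnerProductSpace ℂ H] (π : ProjUnitaryRep G H)

/-- An operator whose matrix with respect to `(π l g)_{l ∈ Λ}` has uniformly summable rows. -/
structure IsLocalizedOp (g : H) (Λ : Set G) (X : H →L[ℂ] H) : Prop where
  exists_row_bound : ∃ M : ℝ≥0∞, M ≠ ∞ ∧
    ∀ i : Λ, ∑' j : Λ, ‖inner ℂ (π (i : G) g) (X (π (j : G) g))‖ₑ ≤ M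
  exists_tail_bound : ∀ ε : ℝ≥0∞, ε ≠ 0 → ∃ C : Set G, IsCompact C ∧ ∀ i : Λ,
    ∑' j : Λ, ((i : G) • C)ᶜ.indicator (fun z => ‖inner ℂ (π (i : G) g) (X (π z g))‖ₑ) (j : G) ≤ ε

variable {π} {g : H} {Λ : Set G}

theorem IsLocalizedOp.add {X Y : H →L[ℂ] H} (hX : π.IsLocalizedOp g Λ X)
    (hY : π.IsLocalizedOp g Λ Y) : π.IsLocalizedOp g Λ (X + Y) := by
  have hle : ∀ a b : H, ‖inner ℂ a ((X + Y) b)‖ₑ ≤ ‖inner ℂ a (X b)‖ₑ + ‖inner ℂ a (Y b)‖ₑ := by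
    intro a b
    rw [add_apply, inner_add_right]
    exact enorm_add_le _ _
  constructor
  · obtain ⟨M, hM, h1⟩ := hX.exists_row_bound
    obtain ⟨M', hM', h2⟩ := hY.exists_row_bound
    refine ⟨M + M', by finiteness, fun i => ?_⟩
    refine (ENNReal.tsum_le_tsum fun j => hle _ _).trans ?_
    rw [ENNReal.tsum_add]
    exact add_le_add (h1 i) (h2 i)
  · intro ε hε
    obtain ⟨C, hC, h1⟩ := hX.exists_tail_bound (ε / 2) (by simpa using hε)
    obtain ⟨C', hC', h2⟩ := hY.exists_tail_bound (ε / 2) (by simpa using hε)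
    refine ⟨C ∪ C', hC.union hC', fun i => ?_⟩
    rw [← ENNReal.add_halves ε]
    refine le_trans ?_ (add_le_add (h1 i) (h2 i))
    rw [← ENNReal.tsum_add]
    refine ENNReal.tsum_le_tsum fun j => ?_
    by_cases hj : (j : G) ∈ (i : G) • (C ∪ C')
    · simp [hj]
    · have hj' := hj
      rw [Set.smul_set_union, Set.mem_union, not_or] at hj'
      rw [Set.indicator_of_mem (by exact hj), Set.indicator_of_mem (by exact hj'.1),
        Set.indicator_of_mem (by exact hj'.2)]
      exact hle _ _

theorem IsLocalizedOp.smul {X : H →L[ℂ] H} (c : ℂ) (hX : π.IsLocalizedOp g Λ X) :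
    π.IsLocalizedOp g Λ (c • X) := by
  have hle : ∀ a b : H, ‖inner ℂ a ((c • X) b)‖ₑ = ‖c‖ₑ * ‖inner ℂ a (X b)‖ₑ := by
    intro a b
    rw [smul_apply, inner_smul_right, enorm_mul]
  constructor
  · obtain ⟨M, hM, h1⟩ := hX.exists_row_bound
    refine ⟨‖c‖ₑ * M, by finiteness, fun i => ?_⟩
    simp_rw [hle]
    rw [ENNReal.tsum_mul_left]
    gcongr
    exact h1 i
  · intro ε hε
    obtain ⟨C, hC, h1⟩ := hX.exists_tail_bound (ε / (‖c‖ₑ + 1))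
      (ENNReal.div_ne_zero.2 ⟨hε, by finiteness⟩)
    refine ⟨C, hC, fun i => ?_⟩
    calc ∑' j : Λ, ((i : G) • C)ᶜ.indicator (fun z => ‖inner ℂ (π (i : G) g) ((c • X) (π z g))‖ₑ)
          (j : G)
        = ‖c‖ₑ * ∑' j : Λ, ((i : G) • C)ᶜ.indicator
            (fun z => ‖inner ℂ (π (i : G) g) (X (π z g))‖ₑ) (j : G) := by
          rw [← ENNReal.tsum_mul_left]
          congr 1 with j
          by_cases hj : (j : G) ∈ (i : G) • C <;> simp [hj]
      _ ≤ (‖c‖ₑ + 1) * (ε / (‖c‖ₑ + 1)) := by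
          gcongr
          · exact le_self_add
          · exact h1 i
      _ = ε := ENNReal.mul_div_cancel (by simp) (by finiteness)

/-- Expanding `S` in the frame dominates the matrix of `X * S` by the product of the matrix of `X`
and the Gram matrix. If `j ∉ i • (C * C')`, then for each intermediate `k` either `k ∉ i • C` or `j
∉ k • C'`, so one factor is always in its tail. -/
theorem IsLocalizedOp.mul_frameOperator [IsTopologicalGroup G] [CompleteSpace H]
    {X S : H →L[ℂ] H} {A B : ℝ}
    (h1 : π.IsLocalizedOp g Λ 1) (hS : IsFrameOperator (fun l : Λ => π (l : G) g) S A B)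
    (hX : π.IsLocalizedOp g Λ X) : π.IsLocalizedOp g Λ (X * S) := by
  let a : Λ → Λ → ℝ≥0∞ := fun i k => ‖inner ℂ (π (i : G) g) (X (π (k : G) g))‖ₑ
  let b : Λ → Λ → ℝ≥0∞ := fun i k => ‖inner ℂ (π (i : G) g) (π (k : G) g)‖ₑ
  have hle : ∀ i j : Λ, ‖inner ℂ (π (i : G) g) ((X * S) (π (j : G) g))‖ₑ
      ≤ ∑' k : Λ, a i k * b k j := by
    intro i j
    have h2 := hS.hasSum (X.adjoint (π (i : G) g)) (π (j : G) g)
    simp only [ContinuousLinearMap.adjoint_inner_left] at h2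
    rw [ContinuousLinearMap.mul_def, ContinuousLinearMap.comp_apply, ← h2.tsum_eq]
    refine enorm_tsum_le_tsum_enorm.trans (le_of_eq ?_)
    simp [a, b, enorm_mul]
  obtain ⟨M, hM, hMX⟩ := hX.exists_row_bound
  obtain ⟨M₁, hM₁, hM1⟩ := h1.exists_row_bound
  constructor
  · refine ⟨M * M₁, by finiteness, fun i => ?_⟩
    refine (ENNReal.tsum_le_tsum fun j => hle i j).trans ?_
    rw [ENNReal.tsum_comm]
    simp_rw [ENNReal.tsum_mul_left]
    calc ∑' k, a i k * ∑' j, b k j ≤ ∑' k, a i k * M₁ :=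
          ENNReal.tsum_le_tsum fun k => mul_le_mul_right (hM1 k) _
      _ ≤ M * M₁ := by
          rw [ENNReal.tsum_mul_right]
          exact mul_le_mul_left (hMX i) _
  · intro ε hε
    have hε2 : ε / 2 ≠ 0 := by simpa using hε
    obtain ⟨C, hC, htX⟩ := hX.exists_tail_bound (ε / 2 / (M₁ + 1))
      (ENNReal.div_ne_zero.2 ⟨hε2, by finiteness⟩)
    obtain ⟨C', hC', ht1⟩ := h1.exists_tail_bound (ε / 2 / (M + 1))
      (ENNReal.div_ne_zero.2 ⟨hε2, by finiteness⟩)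
    refine ⟨C * C', hC.mul hC', fun i => ?_⟩
    let a' : Λ → ℝ≥0∞ := fun k =>
      ((i : G) • C)ᶜ.indicator (fun z => ‖inner ℂ (π (i : G) g) (X (π z g))‖ₑ) (k : G)
    let b' : Λ → Λ → ℝ≥0∞ := fun k j =>
      ((k : G) • C')ᶜ.indicator (fun z => ‖inner ℂ (π (k : G) g) (π z g)‖ₑ) (j : G)
    have hpt : ∀ j : Λ, ((i : G) • (C * C'))ᶜ.indicator
        (fun z => ‖inner ℂ (π (i : G) g) ((X * S) (π z g))‖ₑ) (j : G)
        ≤ ∑' k : Λ, (a' k * b k j + a i k * b' k j) := by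
      intro j
      by_cases hj : (j : G) ∈ (i : G) • (C * C')
      · simp [hj]
      rw [Set.indicator_of_mem (by exact hj)]
      refine (hle i j).trans (ENNReal.tsum_le_tsum fun k => ?_)
      by_cases hk : (k : G) ∈ (i : G) • C
      · have hjk : (j : G) ∉ (k : G) • C' := by
          rintro ⟨z', hz', hj'⟩
          obtain ⟨z, hz, hk'⟩ := hk
          refine hj ⟨z * z', Set.mul_mem_mul hz hz', ?_⟩
          rw [← hj', ← hk']
          simp [mul_assoc]
        have : b' k j = b k j := Set.indicator_of_mem (by exact hjk) _
        rw [this]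
        exact le_add_self
      · have : a' k = a i k := Set.indicator_of_mem (by exact hk) _
        rw [this]
        exact le_self_add
    refine (ENNReal.tsum_le_tsum hpt).trans ?_
    rw [ENNReal.tsum_comm]
    simp_rw [ENNReal.tsum_add, ENNReal.tsum_mul_left]
    rw [← ENNReal.add_halves ε]
    refine add_le_add ?_ ?_
    · calc ∑' k, a' k * ∑' j, b k j ≤ ∑' k, a' k * (M₁ + 1) :=
            ENNReal.tsum_le_tsum fun k => mul_le_mul_right ((hM1 k).trans le_self_add) _
        _ ≤ ε / 2 / (M₁ + 1) * (M₁ + 1) := by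
            rw [ENNReal.tsum_mul_right]
            exact mul_le_mul_left (htX i) _
        _ = ε / 2 := ENNReal.div_mul_cancel (by simp) (by finiteness)
    · calc ∑' k, a i k * ∑' j, b' k j ≤ ∑' k, a i k * (ε / 2 / (M + 1)) :=
            ENNReal.tsum_le_tsum fun k => mul_le_mul_right (ht1 k) _
        _ ≤ (M + 1) * (ε / 2 / (M + 1)) := by
            rw [ENNReal.tsum_mul_right]
            exact mul_le_mul_left ((hMX i).trans le_self_add) _
        _ = ε / 2 := ENNReal.mul_div_cancel (by simp) (by finiteness)

end LocalizedOperators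

/-! ### Boundary effects along strong Følner sequences -/

section Boundary

variable {G : Type*} [Group G] [TopologicalSpace G] [IsTopologicalGroup G] [T2Space G]
  [LocallyCompactSpace G] [SecondCountableTopology G] [MeasurableSpace G] [BorelSpace G]
  {μ : Measure G} [μ.IsHaarMeasure]
  {H : Type*} [NormedAddCommGroup H] [InnerProductSpace ℂ H] {π : ProjUnitaryRep G H}
  {Q : Set G} {Λ : Set G} {N : ℝ≥0∞} {g : H}

/-- The packing bound applied to `x • K n`. The factor `2` comes from `μ (K n * Q) ≤ 2 * μ (K n)`,
which the Følner condition gives eventually. -/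
theorem eventually_encard_inter_smul_le {K : ℕ → Set G} (hK : IsStrongFolnerSeq μ K)
    (hQc : IsCompact Q) (hQs : Q⁻¹ = Q) (hQ1 : Q ∈ 𝓝 (1 : G)) (hN : N ≠ ∞)
    (hΛ : ∀ x : G, ((Λ ∩ x • Q).encard : ℝ≥0∞) ≤ N) :
    ∀ᶠ n in atTop, ∀ x : G, ((Λ ∩ x • K n).encard : ℝ≥0∞) ≤ N * 2 / μ Q * μ (K n) := by
  have hQ0 : μ Q ≠ 0 := (Measure.measure_pos_of_mem_nhds μ hQ1).ne'
  have hQt : μ Q ≠ ∞ := hQc.measure_lt_top.ne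
  have hQn : Q.Nonempty := ⟨1, mem_of_mem_nhds hQ1⟩
  filter_upwards [(hK.tendsto_symmDiff Q hQc hQn).eventually_le_const zero_lt_one] with n hn x
  rw [ENNReal.div_le_iff (hK.measure_ne_zero n) (hK.isCompact n).measure_lt_top.ne, one_mul] at hn
  have h1 := encard_inter_mul_measure_le μ hQc hQs hQ1 hN hΛ (x • K n)
  rw [smul_mul_assoc, measure_smul] at h1
  have h2 : μ (K n * Q) ≤ 2 * μ (K n) := by
    calc μ (K n * Q) ≤ μ (symmDiff (K n * Q) (K n) ∪ K n) := by
          refine measure_mono fun z hz => ?_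
          by_cases hzK : z ∈ K n
          · exact Or.inr hzK
          · exact Or.inl (Or.inl ⟨hz, hzK⟩)
      _ ≤ μ (K n) + μ (K n) := (measure_union_le _ _).trans (by gcongr)
      _ = 2 * μ (K n) := (two_mul _).symm
  have h3 := h1.trans (mul_le_mul_right h2 N)
  rw [← ENNReal.le_div_iff_mul_le (Or.inl hQ0) (Or.inl hQt)] at h3
  refine h3.trans (le_of_eq ?_)
  rw [div_eq_mul_inv, div_eq_mul_inv]
  ring

variable [μ.IsMulRightInvariant]

open Classical in
/-- The interaction across the boundary of `E` between the orbit and its samples in `Λ`. -/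
noncomputable def crossTerm (π : ProjUnitaryRep G H) (g : H) (Λ E : Set G) (y : G) : ℝ≥0∞ :=
  ∑' l : Λ, if (y ∈ E ↔ (l : G) ∈ E) then 0 else ‖inner ℂ (π y g) (π (l : G) g)‖ₑ

theorem lintegral_enorm_coeff_ne_top (hQs : Q⁻¹ = Q) (hQ1 : Q ∈ 𝓝 (1 : G))
    (hg : g ∈ π.B1 μ Q) : ∫⁻ x, ‖π.coeff g g x‖ₑ ∂μ ≠ ∞ := by
  refine ne_top_of_le_ne_top hg.lintegral_lt_top.ne (lintegral_mono fun x => ?_)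
  simpa using π.enorm_coeff_le_localMaximal μ hQs g g x (mem_interior_iff_mem_nhds.2 hQ1)

/-- Three contributions of at most `ε / 3` each, relative to `μ (K n)`. Near the boundary, the
kernel sum is at most `M` on a set of small measure. For `y` deep inside, every crossing point is
far from `y`, and the tail sum is small. For `y` far outside, one integrates in `y` around each `l ∈
x • K n`: the tail integral is small, and the number of such `l` is at most `P * μ (K n)`. -/
theorem eventually_lintegral_crossTerm_le {K : ℕ → Set G} (hK : IsStrongFolnerSeq μ K)
    (hQc : IsCompact Q) (hQs : Q⁻¹ = Q) (hQ1 : Q ∈ 𝓝 (1 : G)) (hg : g ∈ π.B1 μ Q) (hN : N ≠ ∞)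
    (hΛ : ∀ x : G, ((Λ ∩ x • Q).encard : ℝ≥0∞) ≤ N) {ε : ℝ≥0∞} (hε : ε ≠ 0) :
    ∀ᶠ n in atTop, ∀ x : G, ∫⁻ y, crossTerm π g Λ (x • K n) y ∂μ ≤ ε * μ (K n) := by
  classical
  have hQ0 : μ Q ≠ 0 := (Measure.measure_pos_of_mem_nhds μ hQ1).ne'
  have : Countable Λ := (countable_of_encard_inter_smul_le hQ1 hN hΛ).to_subtype
  obtain ⟨M, hM, hMsum⟩ := π.exists_tsum_inner_le μ hQc hQs hQ1 hg hN hΛ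
  have hε3 : ε / 3 ≠ 0 := ENNReal.div_ne_zero.2 ⟨hε, by finiteness⟩
  set P : ℝ≥0∞ := N * 2 / μ Q
  have hP : P ≠ ∞ := ENNReal.div_ne_top (by finiteness) hQ0
  obtain ⟨C₁, hC₁, htail⟩ := π.exists_isCompact_tsum_indicator_inner_le μ hQc hQs hQ1 hg hN hΛ hε3
  obtain ⟨C₂, hC₂, hint⟩ := exists_isCompact_setLIntegral_compl_le μ
    (lintegral_enorm_coeff_ne_top hQs hQ1 hg) (ε := ε / 3 / (P + 1))
    (ENNReal.div_ne_zero.2 ⟨hε3, by finiteness⟩)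
  set C := (C₁ ∪ C₂) ∪ (C₁ ∪ C₂)⁻¹
  have hCc : IsCompact C := (hC₁.union hC₂).union (hC₁.union hC₂).inv
  have hCm : MeasurableSet C := hCc.isClosed.measurableSet
  have hCs : C⁻¹ = C := by simp [C, Set.union_comm]
  -- With `1 ∈ D`, the point `y` lies in the `D`-enlargement of its own side, while `C` places it in
  -- that of the side of `l`.
  set D := C ∪ {1}
  have hD : IsCompact D := hCc.union isCompact_singleton
  have hbd := ((hK.tendsto_boundary D hD).eventually_le_const
    (show 0 < ε / 3 / (M + 1) from
      pos_iff_ne_zero.2 (ENNReal.div_ne_zero.2 ⟨hε3, by finiteness⟩)))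
  filter_upwards [hbd, eventually_encard_inter_smul_le hK hQc hQs hQ1 hN hΛ] with n hn hcard x
  rw [ENNReal.div_le_iff (hK.measure_ne_zero n) (hK.isCompact n).measure_lt_top.ne] at hn
  set T := toMeasurable μ ((K n * D) ∩ ((K n)ᶜ * D))
  have hT : MeasurableSet (x • T) := (measurableSet_toMeasurable _ _).const_smul x
  have hE : MeasurableSet (x • K n) := (hK.isCompact n).isClosed.measurableSet.const_smul x
  let h : G → ℝ≥0∞ := Cᶜ.indicator (fun z => ‖π.coeff g g z‖ₑ)
  have hh : Measurable h :=
    (π.stronglyMeasurable_coeff g g).enorm.indicator hCm.compl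
  have hhl : ∀ l : G, Measurable fun y => h (l⁻¹ * y) := fun l => hh.comp (measurable_const_mul _)
  have hphi : ∀ y l : G, ‖inner ℂ (π y g) (π l g)‖ₑ = ‖π.coeff g g (l⁻¹ * y)‖ₑ := by
    intro y l
    rw [← ofReal_norm, ← ofReal_norm, norm_inner_symm, norm_inner_map_map, coeff, norm_inner_symm]
  -- a pair of points on different sides of the boundary is far apart or near the boundary
  have hcross : ∀ y l : G, ¬ (y ∈ x • K n ↔ l ∈ x • K n) → l ∈ y • C → y ∈ x • T := by
    intro y l hne hl
    refine Set.smul_set_mono (subset_toMeasurable μ _) ?_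
    have hyl : y ∈ l • C := (mem_smul_iff_mem_smul_of_inv_eq hCs _ _).1 hl
    obtain ⟨c, hc, hcl⟩ := hyl
    have hy1 : ∀ s : Set G, y ∈ x • s → y ∈ x • (s * D) := by
      rintro s ⟨k, hk, rfl⟩
      exact ⟨k, ⟨k, hk, 1, Or.inr rfl, mul_one k⟩, rfl⟩
    have hy2 : ∀ s : Set G, l ∈ x • s → y ∈ x • (s * D) := by
      rintro s ⟨k, hk, rfl⟩
      exact ⟨k * c, Set.mul_mem_mul hk (Or.inl hc), by simpa [mul_assoc] using hcl⟩
    rw [Set.smul_set_inter]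
    by_cases hy : y ∈ x • K n
    · have hl' : l ∈ x • (K n)ᶜ := by
        rw [Set.smul_set_compl]
        exact fun hl' => hne ⟨fun _ => hl', fun _ => hy⟩
      exact ⟨hy1 _ hy, hy2 _ hl'⟩
    · have hl' : l ∈ x • K n := by
        by_contra hl'
        exact hne ⟨fun h' => absurd h' hy, fun h' => absurd h' hl'⟩
      have hy' : y ∈ x • (K n)ᶜ := by
        rw [Set.smul_set_compl]
        exact hy
      exact ⟨hy2 _ hl', hy1 _ hy'⟩
  have hpt : ∀ y, crossTerm π g Λ (x • K n) y ≤ (x • T).indicator (fun _ => M) y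
      + (x • K n).indicator (fun _ => ε / 3) y
      + ∑' l : Λ, (x • K n).indicator (fun _ => (1 : ℝ≥0∞)) (l : G) * h ((l : G)⁻¹ * y) := by
    intro y
    by_cases hyT : y ∈ x • T
    · rw [Set.indicator_of_mem hyT, add_assoc]
      refine le_trans ?_ le_self_add
      refine le_trans (ENNReal.tsum_le_tsum fun l => ?_) (hMsum y)
      split_ifs
      · exact zero_le
      · exact le_rfl
    by_cases hy : y ∈ x • K n
    · rw [Set.indicator_of_mem hy, add_assoc]
      refine le_trans ?_ le_add_self
      refine le_trans ?_ le_self_add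
      refine le_trans (ENNReal.tsum_le_tsum fun l => ?_) (htail y)
      split_ifs with hiff
      · exact zero_le
      · have hlC : (l : G) ∉ y • C₁ := fun hl => hyT (hcross y l hiff
          (Set.smul_set_mono (fun z hz => Or.inl (Or.inl hz)) hl))
        rw [Set.indicator_of_mem (by exact hlC)]
    · refine le_trans (ENNReal.tsum_le_tsum fun l => ?_) le_add_self
      split_ifs with hiff
      · exact zero_le
      · have hl : (l : G) ∈ x • K n := by
          by_contra hl'
          exact hiff ⟨fun h' => absurd h' hy, fun h' => absurd h' hl'⟩
        have hlC : (l : G)⁻¹ * y ∈ Cᶜ := by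
          intro hc
          refine hyT (hcross y l hiff ?_)
          rw [mem_smul_iff_mem_smul_of_inv_eq hCs, Set.mem_smul_set_iff_inv_smul_mem]
          exact hc
        rw [Set.indicator_of_mem hl, one_mul, hphi]
        simp only [h]
        rw [Set.indicator_of_mem hlC]
  have hh_int : ∫⁻ z, h z ∂μ ≤ ε / 3 / (P + 1) := by
    rw [lintegral_indicator hCm.compl]
    refine le_trans (lintegral_mono_set ?_) hint
    exact Set.compl_subset_compl.2 fun z hz => Or.inl (Or.inr hz)
  calc ∫⁻ y, crossTerm π g Λ (x • K n) y ∂μ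
      ≤ ∫⁻ y, ((x • T).indicator (fun _ => M) y + (x • K n).indicator (fun _ => ε / 3) y
        + ∑' l : Λ, (x • K n).indicator (fun _ => (1 : ℝ≥0∞)) (l : G) * h ((l : G)⁻¹ * y)) ∂μ :=
        lintegral_mono hpt
    _ = M * μ T + ε / 3 * μ (K n) + ((Λ ∩ x • K n).encard : ℝ≥0∞) * ∫⁻ z, h z ∂μ := by
        rw [lintegral_add_left (by measurability), lintegral_add_left (by measurability),
          lintegral_indicator hT, lintegral_indicator hE, lintegral_const, lintegral_const,
          Measure.restrict_apply_univ, Measure.restrict_apply_univ, measure_smul, measure_smul,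
          lintegral_tsum fun l : Λ => ((hhl (l : G)).const_mul _).aemeasurable]
        simp_rw [lintegral_const_mul _ (hhl _), lintegral_mul_left_eq_self h]
        rw [ENNReal.tsum_mul_right, encard_inter_eq_tsum]
    _ ≤ (M + 1) * (ε / 3 / (M + 1) * μ (K n)) + ε / 3 * μ (K n)
        + (P * μ (K n)) * (ε / 3 / (P + 1)) := by
        gcongr
        · exact le_self_add
        · rw [measure_toMeasurable]
          exact hn
        · exact hcard x
    _ ≤ ε / 3 * μ (K n) + ε / 3 * μ (K n) + ε / 3 * μ (K n) := by
        rw [← mul_assoc, ENNReal.mul_div_cancel (by simp) (by finiteness)]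
        refine add_le_add le_rfl ?_
        calc P * μ (K n) * (ε / 3 / (P + 1)) ≤ (P + 1) * μ (K n) * (ε / 3 / (P + 1)) := by
              gcongr
              exact le_self_add
          _ = (P + 1) * (ε / 3 / (P + 1)) * μ (K n) := by ring
          _ = ε / 3 * μ (K n) := by
              rw [ENNReal.mul_div_cancel (by simp) (by finiteness)]
    _ = ε * μ (K n) := by
        rw [← add_mul, ← add_mul, ENNReal.add_thirds]

end Boundary

end ProjUnitaryRep

/-! ### Averaging the Gram diagonal -/

namespace ProjUnitaryRep

section Removal

variable {G : Type*} [Group G] [MeasurableSpace G]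
  {H : Type*} [NormedAddCommGroup H] [InnerProductSpace ℂ H] {π : ProjUnitaryRep G H}
  {Λ : Set G} {g : H}

/-- Partial sums of the frame expansion of `R S` at a point of the orbit. -/
theorem enorm_sum_inner_mul_inner_le [CompleteSpace H] {S R : H →L[ℂ] H} {A B : ℝ}
    (hS : IsFrameOperator (fun l : Λ => π (l : G) g) S A B) (hR : IsSelfAdjoint R) {δ : ℝ}
    (hδ : ‖1 - R * S‖ ≤ δ) {E : Set G} (F : Finset Λ) (hF : ∀ l : Λ, l ∈ F ↔ (l : G) ∈ E) (y : G) :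
    ‖∑ l ∈ F, inner ℂ (π y g) (R (π (l : G) g)) * inner ℂ (π (l : G) g) (π y g)‖ₑ
      ≤ E.indicator (fun _ => ENNReal.ofReal ((1 + δ) * ‖g‖ ^ 2)) y
        + ENNReal.ofReal (‖R‖ * ‖g‖ ^ 2) * crossTerm π g Λ E y := by
  classical
  set w : Λ → ℂ := fun l => inner ℂ (π y g) (R (π (l : G) g)) * inner ℂ (π (l : G) g) (π y g)
  have hw : ∀ l, ‖w l‖ₑ
      ≤ ENNReal.ofReal (‖R‖ * ‖g‖ ^ 2) * ‖inner ℂ (π y g) (π (l : G) g)‖ₑ := by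
    intro l
    rw [← ofReal_norm, ← ofReal_norm, ← ENNReal.ofReal_mul (by positivity), norm_mul,
      norm_inner_symm (π (l : G) g)]
    refine ENNReal.ofReal_le_ofReal (mul_le_mul_of_nonneg_right ?_ (norm_nonneg _))
    calc ‖inner ℂ (π y g) (R (π (l : G) g))‖ ≤ ‖π y g‖ * ‖R (π (l : G) g)‖ :=
          norm_inner_le_norm _ _
      _ ≤ ‖g‖ * (‖R‖ * ‖g‖) := by
          gcongr
          · simp
          · simpa using R.le_opNorm (π (l : G) g)
      _ = ‖R‖ * ‖g‖ ^ 2 := by ring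
  -- Inside `E` the partial sum differs from the full expansion `⟨π y g, R S π y g⟩` only by terms
  -- crossing the boundary; outside `E` every term crosses it.
  by_cases hy : y ∈ E
  · have hsum : HasSum w (inner ℂ (π y g) (R (S (π y g)))) := by
      have h1 := hS.hasSum (R (π y g)) (π y g)
      have h2 : ∀ a b : H, inner ℂ (R a) b = inner ℂ a (R b) :=
        ContinuousLinearMap.isSelfAdjoint_iff_isSymmetric.1 hR
      simpa only [h2] using h1
    have hfin : HasSum (fun l => if l ∈ F then w l else 0) (∑ l ∈ F, w l) := by
      have h1 : HasSum (fun l => if l ∈ F then w l else 0) (∑ l ∈ F, if l ∈ F then w l else 0) :=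
        hasSum_sum_of_ne_finset_zero fun l hl => by simp [hl]
      rwa [Finset.sum_congr rfl (g := w) fun l hl => by simp [hl]] at h1
    have hdiff := hsum.sub hfin
    have heq : ∑ l ∈ F, w l = inner ℂ (π y g) (R (S (π y g)))
        - ∑' l, (w l - if l ∈ F then w l else 0) := by
      rw [hdiff.tsum_eq]
      ring
    rw [heq, Set.indicator_of_mem hy]
    refine enorm_sub_le.trans (add_le_add ?_ ?_)
    · rw [← ofReal_norm]
      refine ENNReal.ofReal_le_ofReal ?_
      have h3 : R (S (π y g)) = π y g - (1 - R * S) (π y g) := by simp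
      have h4 : ‖R (S (π y g))‖ ≤ (1 + δ) * ‖g‖ := by
        rw [h3]
        refine (norm_sub_le _ _).trans ?_
        have h5 := ((1 - R * S).le_opNorm (π y g)).trans
          (mul_le_mul_of_nonneg_right hδ (norm_nonneg _))
        rw [LinearIsometryEquiv.norm_map] at h5 ⊢
        linarith
      calc ‖inner ℂ (π y g) (R (S (π y g)))‖ ≤ ‖π y g‖ * ‖R (S (π y g))‖ := norm_inner_le_norm _ _
        _ ≤ ‖g‖ * ((1 + δ) * ‖g‖) := by
            rw [LinearIsometryEquiv.norm_map]
            gcongr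
        _ = (1 + δ) * ‖g‖ ^ 2 := by ring
    · refine enorm_tsum_le_tsum_enorm.trans ?_
      rw [crossTerm, ← ENNReal.tsum_mul_left]
      refine ENNReal.tsum_le_tsum fun l => ?_
      by_cases hl : l ∈ F
      · simp [hl]
      · simpa [hl, mt (hF l).2 hl, hy, (hF l).not.1 hl] using hw l
  · rw [Set.indicator_of_notMem hy, zero_add]
    refine (enorm_sum_le _ _).trans ?_
    rw [crossTerm, ← ENNReal.tsum_mul_left]
    refine le_trans (Finset.sum_le_sum fun l hl => ?_) (ENNReal.sum_le_tsum F)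
    rw [if_neg (by simp [hy, (hF l).1 hl])]
    exact hw l

variable [TopologicalSpace G] [IsTopologicalGroup G] [T2Space G]
  [LocallyCompactSpace G] [SecondCountableTopology G] [BorelSpace G]
  {μ : Measure G} [μ.IsHaarMeasure] [μ.IsMulRightInvariant] {Q : Set G} {N : ℝ≥0∞}

/-- If the density of `Λ` exceeds the formal degree, then the points of `Λ` at which the diagonal of
the approximate Gram matrix is at most `α` form a relatively dense set. -/
theorem exists_forall_exists_mem_smul [CompleteSpace H] {K : ℕ → Set G}
    (hK : IsStrongFolnerSeq μ K) (hQc : IsCompact Q) (hQs : Q⁻¹ = Q) (hQ1 : Q ∈ 𝓝 (1 : G))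
    (hg : g ∈ π.B1 μ Q) (hg0 : g ≠ 0) (hN : N ≠ ∞)
    (hΛ : ∀ x : G, ((Λ ∩ x • Q).encard : ℝ≥0∞) ≤ N) {d : ℝ} (hd : π.IsFormalDegree μ d)
    {S R : H →L[ℂ] H} {A B : ℝ} (hS : IsFrameOperator (fun l : Λ => π (l : G) g) S A B)
    (hR : IsSelfAdjoint R) {δ α r : ℝ} (hδ : ‖1 - R * S‖ ≤ δ) (hα : 0 < α) (hr : 0 < r)
    (hdr : d * (1 + δ) < α * r)
    (hdens : ∀ᶠ n in atTop, ENNReal.ofReal r ≤ minRelativeCount μ Λ (K n)) :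
    ∃ n, ∀ x : G, ∃ l ∈ Λ ∩ x • K n, (inner ℂ (π l g) (R (π l g))).re ≤ α := by
  classical
  have hd0 := hd.1
  have hδ0 : 0 ≤ δ := (norm_nonneg _).trans hδ
  have hgn : 0 < ‖g‖ ^ 2 := pow_pos (norm_pos_iff.2 hg0) 2
  -- `η` is the boundary error that still fits in the gap between `d * (1 + δ)` and `α * r`; `‖R‖ +
  -- 1` keeps the denominator positive.
  set η : ℝ := (α * r - d * (1 + δ)) / (2 * (d * (‖R‖ + 1)))
  have hη : 0 < η := div_pos (by linarith) (by positivity)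
  have hη2 : d * (1 + δ) + d * ‖R‖ * η < α * r := by
    have h1 : d * (‖R‖ + 1) * η = (α * r - d * (1 + δ)) / 2 := by
      simp only [η]
      field_simp
    nlinarith [mul_pos hd0 hη]
  have hηne : ENNReal.ofReal η ≠ 0 := by simpa using hη
  obtain ⟨n, hn1, hn2, hn3⟩ := (hdens.and ((eventually_lintegral_crossTerm_le hK hQc hQs hQ1 hg hN
    hΛ hηne).and (eventually_encard_inter_smul_le hK hQc hQs hQ1 hN hΛ))).exists
  refine ⟨n, fun x => ?_⟩
  by_contra! hcon
  have hK0 := hK.measure_ne_zero n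
  have hKt : μ (K n) ≠ ∞ := (hK.isCompact n).measure_lt_top.ne
  have hQ0 : μ Q ≠ 0 := (Measure.measure_pos_of_mem_nhds μ hQ1).ne'
  set E := x • K n
  have hEm : MeasurableSet E := (hK.isCompact n).isClosed.measurableSet.const_smul x
  have hEμ : μ E = μ (K n) := measure_smul _ _ _
  have hfin : (Λ ∩ E).Finite := by
    rw [← Set.encard_lt_top_iff, ← ENat.toENNReal_lt, ENat.toENNReal_top]
    refine (hn3 x).trans_lt ?_
    exact (ENNReal.mul_ne_top (ENNReal.div_ne_top (by finiteness) hQ0) hKt).lt_top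
  have hfin' : {l : Λ | (l : G) ∈ E}.Finite := by
    refine Set.Finite.of_finite_image (f := Subtype.val) (hfin.subset ?_)
      Subtype.val_injective.injOn
    rintro _ ⟨l, hl, rfl⟩
    exact ⟨l.2, hl⟩
  set F := hfin'.toFinset
  have hF : ∀ l : Λ, l ∈ F ↔ (l : G) ∈ E := fun l => by simp [F]
  have hcardF : ((Λ ∩ E).encard : ℝ≥0∞) = F.card := by
    rw [encard_inter_eq_tsum, tsum_eq_sum (s := F) (fun l hl => by simp [(hF l).not.1 hl])]
    rw [Finset.sum_congr rfl (g := fun _ => (1 : ℝ≥0∞)) fun l hl => by simp [(hF l).1 hl]]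
    simp
  have hlow : ENNReal.ofReal r * μ (K n) ≤ F.card := by
    rw [← hcardF, ← ENNReal.le_div_iff_mul_le (Or.inl hK0) (Or.inl hKt)]
    exact hn1.trans (iInf_le _ x)
  -- If all diagonal entries in `x • K n` exceeded `α`, their sum `s` would have modulus at least `α
  -- r μ(K n)`. The orthogonality relations and the cross-term estimate bound it by something
  -- strictly smaller.
  set s : ℂ := ∑ l ∈ F, inner ℂ (π (l : G) g) (R (π (l : G) g))
  have hs : α * F.card ≤ ‖s‖ := by
    refine le_trans ?_ (Complex.re_le_norm s)
    rw [Complex.re_sum, mul_comm, ← nsmul_eq_mul]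
    exact Finset.card_nsmul_le_sum _ _ _ fun l hl => (hcon l ⟨l.2, (hF l).1 hl⟩).le
  have hint : ∫ y, ∑ l ∈ F, inner ℂ (π y g) (R (π (l : G) g)) * inner ℂ (π (l : G) g) (π y g) ∂μ
      = ((d⁻¹ * ‖g‖ ^ 2 : ℝ) : ℂ) * s := by
    rw [integral_finsetSum _ fun l _ => (hd.2 _ _ _ _).1, Finset.mul_sum]
    refine Finset.sum_congr rfl fun l _ => ?_
    rw [(hd.2 _ _ _ _).2, inner_self_eq_norm_sq_to_K (𝕜 := ℂ) g]
    simp only [map_pow, RCLike.conj_ofReal]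
    push_cast
    change (d : ℂ)⁻¹ * _ * ((‖g‖ : ℝ) : ℂ) ^ 2 = _
    ring
  have hupper : ENNReal.ofReal (d⁻¹ * ‖g‖ ^ 2 * ‖s‖)
      ≤ ENNReal.ofReal ((1 + δ) * ‖g‖ ^ 2) * μ (K n)
        + ENNReal.ofReal (‖R‖ * ‖g‖ ^ 2) * (ENNReal.ofReal η * μ (K n)) := by
    calc ENNReal.ofReal (d⁻¹ * ‖g‖ ^ 2 * ‖s‖)
        = ‖∫ y, ∑ l ∈ F, inner ℂ (π y g) (R (π (l : G) g)) * inner ℂ (π (l : G) g) (π y g) ∂μ‖ₑ := by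
          rw [hint, ← ofReal_norm, norm_mul, Complex.norm_real, Real.norm_of_nonneg (by positivity)]
      _ ≤ ∫⁻ y, ‖∑ l ∈ F, inner ℂ (π y g) (R (π (l : G) g))
            * inner ℂ (π (l : G) g) (π y g)‖ₑ ∂μ := enorm_integral_le_lintegral_enorm _
      _ ≤ ∫⁻ y, (E.indicator (fun _ => ENNReal.ofReal ((1 + δ) * ‖g‖ ^ 2)) y
            + ENNReal.ofReal (‖R‖ * ‖g‖ ^ 2) * crossTerm π g Λ E y) ∂μ :=
          lintegral_mono fun y => enorm_sum_inner_mul_inner_le hS hR hδ F hF y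
      _ = ENNReal.ofReal ((1 + δ) * ‖g‖ ^ 2) * μ (K n)
            + ENNReal.ofReal (‖R‖ * ‖g‖ ^ 2) * ∫⁻ y, crossTerm π g Λ E y ∂μ := by
          rw [lintegral_add_left (measurable_const.indicator hEm), lintegral_indicator hEm,
            lintegral_const, Measure.restrict_apply_univ, hEμ,
            lintegral_const_mul' _ _ ENNReal.ofReal_ne_top]
      _ ≤ _ := by
          gcongr
          exact hn2 x
  set m : ℝ := (μ (K n)).toReal
  have hm : 0 < m := ENNReal.toReal_pos hK0 hKt
  rw [← ENNReal.ofReal_toReal hKt] at hupper hlow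
  rw [← ENNReal.ofReal_mul hη.le, ← ENNReal.ofReal_mul (by positivity),
    ← ENNReal.ofReal_mul (by positivity), ← ENNReal.ofReal_add (by positivity) (by positivity),
    ENNReal.ofReal_le_ofReal_iff (by positivity)] at hupper
  rw [← ENNReal.ofReal_mul hr.le, ← ENNReal.ofReal_natCast,
    ENNReal.ofReal_le_ofReal_iff (by positivity)] at hlow
  have h1 : α * r * m ≤ ‖s‖ := le_trans (by rw [mul_assoc]; gcongr) hs
  have h2 : ‖s‖ ≤ (d * (1 + δ) + d * ‖R‖ * η) * m := by
    have h3 : d⁻¹ * ‖g‖ ^ 2 * ‖s‖ ≤ d⁻¹ * ‖g‖ ^ 2 * ((d * (1 + δ) + d * ‖R‖ * η) * m) := by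
      refine hupper.trans (le_of_eq ?_)
      field_simp
      rfl
    exact le_of_mul_le_mul_left h3 (by positivity)
  nlinarith [mul_lt_mul_of_pos_right hη2 hm]

end Removal

end ProjUnitaryRep

/-! ### Choice of the removed set and conclusion -/

/-- Maximal separated subsets: every set `Λ` contains a `C`-separated subset `J` with
`Λ ⊆ J C ∪ J`. -/
theorem exists_maximal_separated {G : Type*} [Group G] {C : Set G} (hC : C⁻¹ = C) (Λ : Set G) :
    ∃ J ⊆ Λ, (∀ i ∈ J, ∀ j ∈ J, j ∈ i • C → j = i) ∧ ∀ l ∈ Λ, l ∈ J ∨ ∃ i ∈ J, l ∈ i • C := by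
  obtain ⟨J, hJ⟩ := zorn_subset
    {J : Set G | J ⊆ Λ ∧ ∀ i ∈ J, ∀ j ∈ J, j ∈ i • C → j = i} (by
      intro c hc hchain
      refine ⟨⋃₀ c, ⟨Set.sUnion_subset fun s hs => (hc hs).1, ?_⟩, fun s hs =>
        Set.subset_sUnion_of_mem hs⟩
      rintro i ⟨s, hs, his⟩ j ⟨t, ht, hjt⟩ hij
      rcases hchain.total hs ht with hst | hts
      · exact (hc ht).2 i (hst his) j hjt hij
      · exact (hc hs).2 i his j (hts hjt) hij)
  refine ⟨J, hJ.prop.1, hJ.prop.2, fun l hl => ?_⟩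
  by_contra! hcon
  obtain ⟨hlJ, hlC⟩ := hcon
  refine hlJ (hJ.le_of_ge ⟨Set.insert_subset hl hJ.prop.1, ?_⟩ (Set.subset_insert l J)
    (Set.mem_insert l J))
  rintro i (rfl | hi) j (rfl | hj) hij
  · rfl
  · exact absurd ((mem_smul_iff_mem_smul_of_inv_eq hC _ _).1 hij) (hlC j hj)
  · exact absurd hij (hlC i hi)
  · exact hJ.prop.2 i hi j hj hij

theorem theorem1p1
    {G : Type*} [Group G] [TopologicalSpace G] [IsTopologicalGroup G] [T2Space G]
    [LocallyCompactSpace G] [SecondCountableTopology G] [MeasurableSpace G] [BorelSpace G]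
    -- a Haar measure, right-invariant because `G` is unimodular
    (μ : Measure G) [μ.IsHaarMeasure] [μ.IsMulRightInvariant]
    (hG : IsAmenableGroup μ)
    -- the fixed compact symmetric unit neighbourhood
    (Q : Set G) (hQc : IsCompact Q) (hQs : Q⁻¹ = Q) (hQ1 : Q ∈ 𝓝 (1 : G))
    {H : Type*} [NormedAddCommGroup H] [InnerProductSpace ℂ H] [CompleteSpace H]
    (π : ProjUnitaryRep G H) (hπ : π.IsIntegrableRep μ)
    (Λ : Set G) (hΛ : IsDiscrete Λ)
    (g : H) (hg : g ∈ π.B1 μ Q)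
    (hframe : IsHilbertFrame (fun l : Λ => π (l : G) g))
    -- the density of `Λ`, computed along some strong Følner sequence, exceeds the formal degree
    (K : ℕ → Set G) (hK : IsStrongFolnerSeq μ K)
    (hdens : ENNReal.ofReal (π.formalDegree μ) < lowerBeurlingDensity μ K Λ) :
    ∃ Γ : Set G, Γ ⊆ Λ ∧
      (∃ D : ℝ≥0∞, 0 < D ∧ HasLowerBeurlingDensity μ Γ D) ∧
      IsHilbertFrame (fun l : (Λ \ Γ : Set G) => π (l : G) g) := by
  have := isInvInvariant_of_isMulRightInvariant μ
  set d := π.formalDegree μ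
  have hd : π.IsFormalDegree μ d := hπ.isFormalDegree_formalDegree
  have hd0 := hd.1
  obtain ⟨S, A, B, hB, hS⟩ := hframe.exists_isFrameOperator
  have hA := hS.pos
  obtain ⟨h₀, hh₀, -⟩ := hπ.exists_integrable_vector
  have hAB : A ≤ B := by
    have h1 := (hS.lower h₀).trans (hS.upper h₀)
    exact le_of_mul_le_mul_right h1 (pow_pos (norm_pos_iff.2 hh₀) 2)
  have hg0 : g ≠ 0 := by
    rintro rfl
    have h1 := hS.lower h₀
    have h2 := (hS.hasSum_sq h₀).tsum_eq
    simp only [map_zero, inner_zero_left, norm_zero, ne_eq, OfNat.ofNat_ne_zero, not_false_eq_true,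
      zero_pow, tsum_zero] at h2
    rw [← h2] at h1
    exact h1.not_gt (mul_pos hA (pow_pos (norm_pos_iff.2 hh₀) 2))
  obtain ⟨N, hN, hsep⟩ := π.exists_encard_inter_smul_le μ hg0 ENNReal.ofReal_ne_top
    hS.tsum_enorm_sq_le hQc
  -- the parameters
  obtain ⟨r', hr'd, hr'⟩ := exists_between hdens
  have hr't : r' ≠ ∞ := (hr'.trans_le le_top).ne
  obtain ⟨r, rfl⟩ : ∃ r : ℝ, r' = ENNReal.ofReal r := ⟨r'.toReal, (ENNReal.ofReal_toReal hr't).symm⟩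
  have hdr : d < r := (ENNReal.ofReal_lt_ofReal_iff_of_nonneg hd0.le).1 hr'd
  have hr0 : 0 < r := hd0.trans hdr
  have hdens' : ∀ᶠ n in atTop, ENNReal.ofReal r ≤ minRelativeCount μ Λ (K n) :=
    (eventually_lt_of_lt_liminf hr').mono fun n hn => hn.le
  obtain ⟨α, hα1, hα2⟩ := exists_between ((div_lt_one hr0).2 hdr)
  have hα0 : 0 < α := (div_pos hd0 hr0).trans hα1
  have hdα : d < α * r := (div_lt_iff₀ hr0).1 hα1
  have h1α : 0 < 1 - α := by linarith
  -- The first condition preserves the density gap. The second spends half of the budget `(1 - α) ^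
  -- 2 / 2` of the removal estimate.
  obtain ⟨δ, hδ0, hδ1, hδ2⟩ : ∃ δ : ℝ, 0 < δ ∧ d * (1 + δ) < α * r ∧
      3 * (B / A * δ ^ 2) ≤ (1 - α) ^ 2 / 4 := by
    have hc1 : Tendsto (fun δ : ℝ => d * (1 + δ)) (𝓝[>] 0) (𝓝 (d * (1 + 0))) :=
      Continuous.tendsto' (by fun_prop) _ _ rfl |>.mono_left nhdsWithin_le_nhds
    have hc2 : Tendsto (fun δ : ℝ => 3 * (B / A * δ ^ 2)) (𝓝[>] 0) (𝓝 (3 * (B / A * 0 ^ 2))) :=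
      Continuous.tendsto' (by fun_prop) _ _ rfl |>.mono_left nhdsWithin_le_nhds
    have e1 := hc1.eventually_lt_const (by simpa using hdα)
    have e2 := hc2.eventually_le_const (u := (1 - α) ^ 2 / 4) (by simp; positivity)
    obtain ⟨δ, h1, h2, h3⟩ := (e1.and (e2.and self_mem_nhdsWithin)).exists
    exact ⟨δ, h3, h1, h2⟩
  -- the localised approximate inverse
  have hloc1 : π.IsLocalizedOp g Λ 1 := by
    constructor
    · obtain ⟨M, hM, h⟩ := π.exists_tsum_inner_le μ hQc hQs hQ1 hg hN hsep
      exact ⟨M, hM, fun i => h i⟩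
    · intro ε hε
      obtain ⟨C, hC, h⟩ := π.exists_isCompact_tsum_indicator_inner_le μ hQc hQs hQ1 hg hN hsep hε
      exact ⟨C, hC, fun i => h i⟩
  obtain ⟨R, hR, hRloc, hRδ⟩ := hS.exists_approx_inverse hB hAB (π.IsLocalizedOp g Λ) hloc1
    (fun _ _ h h' => h.add h') (fun c _ h => h.smul c) (fun _ h => hloc1.mul_frameOperator hS h) hδ0
  obtain ⟨n, hn⟩ := ProjUnitaryRep.exists_forall_exists_mem_smul hK hQc hQs hQ1 hg hg0 hN hsep hd
    hS hR hRδ hα0 hr0 hδ1 hdens'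
  -- a sparse, relatively dense set of indices
  obtain ⟨M, hM, hrow⟩ := hRloc.exists_row_bound
  -- Then `3 * ε ^ 2 ≤ (1 - α) ^ 2 / 4`, which fits in the half of the budget left by `δ`.
  set ε : ℝ := (1 - α) / 4
  have hε : 0 < ε := by positivity
  obtain ⟨C₀, hC₀, htail⟩ := hRloc.exists_tail_bound (ENNReal.ofReal ε) (by simpa using hε)
  set C := C₀ ∪ C₀⁻¹
  have hC : IsCompact C := hC₀.union hC₀.inv
  have hCs : C⁻¹ = C := by simp [C, Set.union_comm]
  obtain ⟨Γ, hΓ, hΓsep, hΓmax⟩ := exists_maximal_separated hCs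
    {l ∈ Λ | (inner ℂ (π l g) (R (π l g))).re ≤ α}
  have hΓΛ : Γ ⊆ Λ := fun l hl => (hΓ hl).1
  refine ⟨Γ, hΓΛ, ⟨_, ?_, hasLowerBeurlingDensity_iSup μ hQc hQs hQ1 hN fun x =>
    le_trans ?_ (hsep x)⟩, ?_⟩
  -- Every `x • K n` contains a point with small diagonal entry, and by maximality that point is in
  -- `Γ` or within `C` of `Γ`. So `Γ` meets every `x • L`, and its density is at least `(μ L)⁻¹`.
  · set L := K n * (C ∪ {1})
    have hL : IsCompact L := (hK.isCompact n).mul (hC.union isCompact_singleton)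
    have hKL : K n ⊆ L := fun z hz => ⟨z, hz, 1, Or.inr rfl, mul_one z⟩
    have hL0 : μ L ≠ 0 := fun h => hK.measure_ne_zero n (measure_mono_null hKL h)
    refine lt_of_lt_of_le (b := (μ L)⁻¹) (by simpa using hL.measure_lt_top.ne)
      (le_iSup_of_le L (le_iSup_of_le hL (le_iSup_of_le hL0 (le_iInf fun x => ?_))))
    obtain ⟨l, ⟨hlΛ, k, hk, hkl⟩, hlα⟩ := hn x
    obtain ⟨i, hi, hiL⟩ : ∃ i ∈ Γ, i ∈ x • L := by
      rcases hΓmax l ⟨hlΛ, hlα⟩ with h | ⟨i, hi, hil⟩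
      · exact ⟨l, h, k, hKL hk, hkl⟩
      · refine ⟨i, hi, ?_⟩
        obtain ⟨c, hc, hci⟩ := (mem_smul_iff_mem_smul_of_inv_eq hCs _ _).1 hil
        exact ⟨k * c, Set.mul_mem_mul hk (Or.inl hc), by simp [← hci, ← hkl, mul_assoc]⟩
    rw [← one_div]
    refine ENNReal.div_le_div_right ?_ _
    rw [← ENat.toENNReal_one, ENat.toENNReal_le, Set.one_le_encard_iff_nonempty]
    exact ⟨i, hi, hiL⟩
  · rw [ENat.toENNReal_le]
    exact Set.encard_le_encard (Set.inter_subset_inter_left _ hΓΛ)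
  -- the remaining vectors form a frame
  let J : Set Λ := {l | (l : G) ∈ Γ}
  -- Separation puts every other point of `Γ` outside `i • C₀`, so the off-diagonal row sum is part
  -- of the tail of `R`.
  have hoff : ∀ i ∈ J, ∑' j : Λ, (J \ {i}).indicator
      (fun j : Λ => ‖inner ℂ (π (i : G) g) (R (π (j : G) g))‖ₑ) j ≤ ENNReal.ofReal ε := by
    intro i hi
    refine le_trans (ENNReal.tsum_le_tsum fun j => ?_) (htail i)
    by_cases hj : j ∈ J \ {i}
    · have hjC : (j : G) ∉ (i : G) • C₀ := fun h => hj.2 (Subtype.ext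
        (hΓsep i hi j hj.1 (Set.smul_set_mono (fun z hz => Or.inl hz) h)))
      rw [Set.indicator_of_mem hj, Set.indicator_of_mem (by exact hjC)]
    · rw [Set.indicator_of_notMem hj]
      exact zero_le
  obtain ⟨A', hA', hlow⟩ := hS.exists_lower_bound_compl hB hR hα2 hε.le (J := J)
    (fun i hi => (hΓ hi).2) hoff hM hrow hRδ (by simp only [ε]; nlinarith [sq_nonneg (1 - α)])
  let e : (Λ \ Γ : Set G) ≃ (Jᶜ : Set Λ) :=
    { toFun := fun l => ⟨⟨l, l.2.1⟩, l.2.2⟩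
      invFun := fun l => ⟨l.1, l.1.2, l.2⟩
      left_inv := fun _ => rfl
      right_inv := fun _ => rfl }
  refine ⟨A', B, hA', hB, fun f => ?_⟩
  have hsum : Summable fun l : (Jᶜ : Set Λ) => ‖inner ℂ (π (l : G) g) f‖ ^ 2 :=
    (hS.hasSum_sq f).summable.subtype Jᶜ
  have htsum : ∑' l : (Λ \ Γ : Set G), ‖inner ℂ (π (l : G) g) f‖ ^ 2
      = ∑' l : (Jᶜ : Set Λ), ‖inner ℂ (π (l : G) g) f‖ ^ 2 :=
    e.tsum_eq fun l : (Jᶜ : Set Λ) => ‖inner ℂ (π (l : G) g) f‖ ^ 2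
  refine ⟨e.summable_iff.2 hsum, ?_, ?_⟩
  · rw [htsum]
    have h1 := hlow f
    rw [← ofReal_norm, ← ENNReal.ofReal_pow (norm_nonneg _), ← ENNReal.ofReal_mul hA'.le] at h1
    rw [← ENNReal.ofReal_le_ofReal_iff (tsum_nonneg fun _ => by positivity),
      ENNReal.ofReal_tsum_of_nonneg (fun _ => by positivity) hsum]
    refine h1.trans (le_of_eq ?_)
    congr 1 with l
    rw [ENNReal.ofReal_pow (norm_nonneg _), ofReal_norm]
  · rw [htsum]
    refine le_trans ?_ (hS.upper f)
    rw [← (hS.hasSum_sq f).tsum_eq]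
    exact (hS.hasSum_sq f).summable.tsum_subtype_le _ Jᶜ fun _ => by positivity
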